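/- Let $D$ be an integral domain with quotient field $K$, and let $*$ be a star-operation of finite character on $D$, i.e. a map $A\mapsto A_*$ on the nonzero fractional ideals of $D$ such that for all nonzero fractional ideals $A,B$ and $0\ne x\in K$: $(x)_*=(x)$, $(xA)_*=xA_*$; $A\subseteq A_*$, and $A\subseteq B$ implies $A_*\subseteq B_*$; $(A_*)_*=A_*$; and $A_*=\bigcup\{B_* : 0\ne B\subseteq A,\ B \text{ a finitely generated fractional ideal}\}$. Definitions. Write $A^{-1}=\{x\in K: xA\subseteq D\}$ and $A_v=(A^{-1})^{-1}$; $A$ is *$*$-invertible* if $(AA^{-1})_*=D$. A *maximal $*$-ideal* is an ideal maximal among the nonzero proper ideals $I$ of $D$ with $I_*=I$. A *$*$-product* of ideals $A_1,\dots,A_k$ is $(A_1\cdots A_k)_*$. - A nonzero ideal $A$ of $D$ is *$*$-homogeneous* if it is finitely generated and contained in exactly one maximal $*$-ideal, denoted $M(A)$. It has *type 2* if moreover $A_*=(M(A)^n)_*$ for some $n\ge1$. - An ideal $A$ is *$*$-afg-homogeneous* if it is $*$-invertible and $*$-homogeneous, and whenever $b_1,\dots,b_s\in M(A)$ satisfy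 $A^r\subseteq(b_1,\dots,b_s)_*$ for some $r\ge1$, there is $n\ge1$ such that $(b_1^n,\dots,b_s^n)_*$ is principal. - A $*$-homogeneous ideal $A$ is *$*$-af-homogeneous* if for every $*$-homogeneous ideal $B\supseteq A$ there is $n\ge1$ such that $(B^n)_*$ is principal. - $D$ is a *$*$-afg-SH domain of type 2* (respectively a *$*$-af-SH domain of type 2*) if every nonzero proper principal ideal of $D$ is a finite $*$-product of $*$-afg-homogeneous (respectively $*$-af-homogeneous) ideals of type 2. - $D$ is a *$*$-Krull domain* if the set of maximal $*$-ideals consists of prime ideals and is equal to the set of height-one primes of $D$; $D=\bigcap_P D_P$ over the maximal $*$-ideals $P$; every nonzero nonunit of $D$ lies in only finitely many maximal $*$-ideals; no two distinct maximal $*$-ideals contain a common nonzero prime ideal; and $D_P$ is a discrete valuation ring for each maximal $*$-ideal $P$. - $D$ is an *AGCD-domain* if for all nonzero $a,b\in D$ there is $n\ge1$ such that $(a^n,b^n)_v$ is principal. - $Cl_*(D)$ is the group of $*$-invertible fractional ideals $I$ with $I=I_*$, under $(I,J)\mapsto(IJ)_*$, modulo the subgroup of nonzero principal fractional ideals. Corollary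 5.8. The following statements are equivalent. 1. $D$ is a $*$-afg-SH domain of type 2. 2. $D$ is a $*$-Krull domain and an AGCD-domain. 3. For every finitely generated $*$-invertible ideal $A$ of $D$ with $A_*\neq D$, the ideal $A_*$ is a $*$-product of $*$-afg-homogeneous ideals of type 2. 4. $D$ is a $*$-Krull domain and $Cl_*(D)$ is a torsion group. 5. $D$ is a $*$-af-SH domain of type 2. -/

import Mathlib

open scoped nonZeroDivisors

/-- A star-operation on a domain `D` with quotient field `K`.  The map is given on all fractional
ideals, with the convention `0_* = 0`; all the content is on the nonzero ones. -/
structure StarOperation (D K : Type*) [CommRing D] [IsDomain D] [Field K] [Algebra D K]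
    [IsFractionRing D K] where
  toFun : FractionalIdeal D⁰ K → FractionalIdeal D⁰ K
  map_zero' : toFun 0 = 0
  map_spanSingleton' : ∀ x : K, x ≠ 0 →
    toFun (FractionalIdeal.spanSingleton D⁰ x) = FractionalIdeal.spanSingleton D⁰ x
  map_spanSingleton_mul' : ∀ (x : K) (A : FractionalIdeal D⁰ K), x ≠ 0 → A ≠ 0 →
    toFun (FractionalIdeal.spanSingleton D⁰ x * A) = FractionalIdeal.spanSingleton D⁰ x * toFun A
  le_map' : ∀ A : FractionalIdeal D⁰ K, A ≠ 0 → A ≤ toFun A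
  monotone' : ∀ A B : FractionalIdeal D⁰ K, A ≠ 0 → B ≠ 0 → A ≤ B → toFun A ≤ toFun B
  map_map' : ∀ A : FractionalIdeal D⁰ K, A ≠ 0 → toFun (toFun A) = toFun A

section Domains

variable (D K : Type*) [CommRing D] [IsDomain D] [Field K] [Algebra D K] [IsFractionRing D K]

/-- The fractional ideal `I` is principal. -/
def IsPrincipalFractional {D K : Type*} [CommRing D] [IsDomain D] [Field K] [Algebra D K]
    [IsFractionRing D K] (I : FractionalIdeal D⁰ K) : Prop :=
  ∃ c : K, I = FractionalIdeal.spanSingleton D⁰ c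

/-- Almost GCD domains: for nonzero `a, b` some `(a ^ n, b ^ n)_v`, `n ≥ 1`, is principal, where
`A_v = (A⁻¹)⁻¹`. -/
def IsAGCDDomain : Prop :=
  ∀ a b : D, a ≠ 0 → b ≠ 0 → ∃ n : ℕ, 0 < n ∧
    IsPrincipalFractional
      (((Ideal.span {a ^ n, b ^ n} : Ideal D) : FractionalIdeal D⁰ K)⁻¹)⁻¹

/-- The localization `D_P` at a prime ideal `P`, as a subset of the quotient field `K`. -/
def localizationIn {D : Type*} (K : Type*) [CommRing D] [Field K] [Algebra D K]
    (P : Ideal D) : Set K :=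
  {x | ∃ a s : D, s ∉ P ∧ x = algebraMap D K a / algebraMap D K s}

/-- `D` is an `F`-IFC domain: `F` is a set of prime ideals that is a defining family
(`D = ⋂ D_P`), of finite character, and independent. -/
structure IsIFCDomain (F : Set (Ideal D)) : Prop where
  prime : ∀ P ∈ F, P.IsPrime
  defining : (⋂ P ∈ F, localizationIn K P) = Set.range (algebraMap D K)
  finite : ∀ x : D, x ≠ 0 → ¬ IsUnit x → {P ∈ F | x ∈ P}.Finite
  independent : ∀ P ∈ F, ∀ Q ∈ F, P ≠ Q → ∀ R : Ideal D, R.IsPrime → R ≤ P → R ≤ Q → R = ⊥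

/-- `X⁽¹⁾(D)`, the set of height-one prime ideals. -/
def heightOnePrimes (D : Type*) [CommRing D] : Set (Ideal D) :=
  {P | P.IsPrime ∧ P.height = 1}

end Domains

namespace StarOperation

variable {D K : Type*} [CommRing D] [IsDomain D] [Field K] [Algebra D K] [IsFractionRing D K]

instance : CoeFun (StarOperation D K)
    (fun _ => FractionalIdeal D⁰ K → FractionalIdeal D⁰ K) := ⟨StarOperation.toFun⟩

variable (σ : StarOperation D K)

/-- `A_* = ⋃ B_*`, over the nonzero finitely generated fractional ideals `B ⊆ A`. -/
def FiniteCharacter : Prop :=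
  ∀ A : FractionalIdeal D⁰ K, A ≠ 0 → ∀ x : K, x ∈ σ A ↔
    ∃ B : FractionalIdeal D⁰ K, B ≠ 0 ∧ (B : Submodule D K).FG ∧ B ≤ A ∧ x ∈ σ B

/-- `A` is `*`-invertible: `(A A⁻¹)_* = D`. -/
def Invertible (A : FractionalIdeal D⁰ K) : Prop := σ (A * A⁻¹) = 1

/-- The maximal `*`-ideals: maximal among the nonzero proper ideals `I` with `I_* = I`. -/
def maxIdeals : Set (Ideal D) :=
  {P | Maximal (fun I : Ideal D => I ≠ ⊥ ∧ I ≠ ⊤ ∧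
    σ (I : FractionalIdeal D⁰ K) = (I : FractionalIdeal D⁰ K)) P}

/-- `D` is `*`-h-local. -/
def IsHLocal : Prop := IsIFCDomain D K σ.maxIdeals

/-- `D` is a `*`-weakly Krull domain. -/
def IsWeaklyKrullDomain : Prop := σ.IsHLocal ∧ σ.maxIdeals = heightOnePrimes D

/-- `D` is a `*`-Krull domain. -/
def IsKrullDomain : Prop :=
  σ.IsWeaklyKrullDomain ∧ ∀ P ∈ σ.maxIdeals, ∀ _ : P.IsPrime,
    IsDiscreteValuationRing (Localization.AtPrime P)

/-- `A` is `P`-`*`-homogeneous: nonzero, finitely generated, and `P = M(A)` is the unique maximal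
`*`-ideal containing `A`. -/
structure IsHomogeneousAt (A P : Ideal D) : Prop where
  ne_bot : A ≠ ⊥
  fg : A.FG
  mem : P ∈ σ.maxIdeals
  le : A ≤ P
  unique : ∀ Q ∈ σ.maxIdeals, A ≤ Q → Q = P

/-- `A` is `*`-homogeneous. -/
def IsHomogeneous (A : Ideal D) : Prop := ∃ P, σ.IsHomogeneousAt A P

/-- `A` is a type 2 `*`-homogeneous ideal: `A_* = (M(A) ^ n)_*` for some `n ≥ 1`. -/
def IsType2Homogeneous (A : Ideal D) : Prop :=
  ∃ P, σ.IsHomogeneousAt A P ∧ ∃ n : ℕ, 1 ≤ n ∧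
    σ (A : FractionalIdeal D⁰ K) = σ ((P ^ n : Ideal D) : FractionalIdeal D⁰ K)

/-- `A` is `*`-almost factorial general-homogeneous: `*`-invertible, `P`-`*`-homogeneous for some
`P`, and whenever `b₁, …, bₛ ∈ P` with `A ^ r ⊆ (b₁, …, bₛ)_*` for some `r ≥ 1`, there is `n ≥ 1`
with `(b₁ ^ n, …, bₛ ^ n)_*` principal. -/
def IsAfgHomogeneous (A : Ideal D) : Prop :=
  ∃ P, σ.IsHomogeneousAt A P ∧ σ.Invertible (A : FractionalIdeal D⁰ K) ∧
    ∀ (s : ℕ) (b : Fin s → D), (∀ i, b i ∈ P) →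
      (∃ r : ℕ, 0 < r ∧ ((A ^ r : Ideal D) : FractionalIdeal D⁰ K) ≤
        σ ((Ideal.span (Set.range b) : Ideal D) : FractionalIdeal D⁰ K)) →
      ∃ n : ℕ, 0 < n ∧ IsPrincipalFractional
        (σ ((Ideal.span (Set.range fun i => b i ^ n) : Ideal D) : FractionalIdeal D⁰ K))

/-- `A` is `*`-almost factorial-homogeneous: `*`-homogeneous, and every `*`-homogeneous `B ⊇ A` has
some `(B ^ n)_*`, `n ≥ 1`, principal. -/
def IsAfHomogeneous (A : Ideal D) : Prop :=
  σ.IsHomogeneous A ∧ ∀ B : Ideal D, σ.IsHomogeneous B → A ≤ B →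
    ∃ n : ℕ, 0 < n ∧ IsPrincipalFractional (σ ((B ^ n : Ideal D) : FractionalIdeal D⁰ K))

/-- `I` is a (finite) `*`-product `(A₁ ⋯ Aₖ)_*` of ideals with the property `p`. -/
def IsStarProductOf (p : Ideal D → Prop) (I : FractionalIdeal D⁰ K) : Prop :=
  ∃ s : Multiset (Ideal D), (∀ A ∈ s, p A) ∧ I = σ ((s.prod : Ideal D) : FractionalIdeal D⁰ K)

/-- Every nonzero proper principal ideal of `D` is a `*`-product of ideals with the property `p`. -/
def PrincipalIdealsAreProductsOf (p : Ideal D → Prop) : Prop :=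
  ∀ x : D, x ≠ 0 → ¬ IsUnit x →
    σ.IsStarProductOf p ((Ideal.span {x} : Ideal D) : FractionalIdeal D⁰ K)

/-- `D` is a `*`-afg-SH domain of type 2. -/
def IsType2AfgSHDomain : Prop :=
  σ.PrincipalIdealsAreProductsOf fun A => σ.IsAfgHomogeneous A ∧ σ.IsType2Homogeneous A

/-- `D` is a `*`-af-SH domain of type 2. -/
def IsType2AfSHDomain : Prop :=
  σ.PrincipalIdealsAreProductsOf fun A => σ.IsAfHomogeneous A ∧ σ.IsType2Homogeneous A

/-! ### The `*`-class group -/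

theorem map_zero : σ 0 = 0 := σ.map_zero'

theorem map_one : σ 1 = 1 := by
  simpa using σ.map_spanSingleton' 1 one_ne_zero

theorem le_map (A : FractionalIdeal D⁰ K) : A ≤ σ A := by
  by_cases h : A = 0
  · subst h; rw [σ.map_zero]
  · exact σ.le_map' A h

theorem mono {A B : FractionalIdeal D⁰ K} (h : A ≤ B) : σ A ≤ σ B := by
  by_cases hA : A = 0
  · subst hA; rw [σ.map_zero]; exact FractionalIdeal.zero_le _
  · have hB : B ≠ 0 := by
      rintro rfl
      exact hA (le_antisymm h (FractionalIdeal.zero_le _))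
    exact σ.monotone' A B hA hB h

theorem map_map (A : FractionalIdeal D⁰ K) : σ (σ A) = σ A := by
  by_cases h : A = 0
  · subst h; rw [σ.map_zero, σ.map_zero]
  · exact σ.map_map' A h

theorem map_spanSingleton (x : K) :
    σ (FractionalIdeal.spanSingleton D⁰ x) = FractionalIdeal.spanSingleton D⁰ x := by
  by_cases h : x = 0
  · subst h; simp [σ.map_zero]
  · exact σ.map_spanSingleton' x h

theorem map_mul_le (A B : FractionalIdeal D⁰ K) : σ A * B ≤ σ (A * B) := by
  by_cases hA : A = 0
  · subst hA; simp [σ.map_zero]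
  rw [FractionalIdeal.mul_le]
  intro a ha b hb
  by_cases h : b = 0
  · subst h
    rw [mul_zero]
    exact (σ (A * B)).zero_mem
  have h1 : FractionalIdeal.spanSingleton D⁰ b * A ≤ A * B := by
    rw [mul_comm]
    exact mul_le_mul_right (FractionalIdeal.spanSingleton_le_iff_mem.2 hb) A
  have h2 := σ.mono h1
  rw [σ.map_spanSingleton_mul' b A h hA] at h2
  apply h2
  rw [mul_comm a b]
  exact FractionalIdeal.mul_mem_mul (FractionalIdeal.mem_spanSingleton_self D⁰ b) ha

theorem map_map_mul (A B : FractionalIdeal D⁰ K) : σ (σ A * B) = σ (A * B) :=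
  le_antisymm ((σ.mono (σ.map_mul_le A B)).trans_eq (σ.map_map _))
    (σ.mono (mul_le_mul_left (σ.le_map A) B))

theorem map_mul_map (A B : FractionalIdeal D⁰ K) : σ (A * σ B) = σ (A * B) := by
  rw [mul_comm, σ.map_map_mul, mul_comm]

theorem invertible_of_mul {A B : FractionalIdeal D⁰ K} (h : σ (A * B) = 1) : σ.Invertible A := by
  have hA : A ≠ 0 := by
    rintro rfl
    rw [zero_mul, σ.map_zero] at h
    exact zero_ne_one h
  have hAB : A * B ≤ 1 := (σ.le_map _).trans_eq h
  have hB : B ≤ A⁻¹ := by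
    rw [FractionalIdeal.inv_eq, FractionalIdeal.le_div_iff_mul_le hA, mul_comm]
    exact hAB
  refine le_antisymm ?_ ?_
  · exact (σ.mono FractionalIdeal.mul_one_div_le_one).trans_eq σ.map_one
  · exact h.symm.trans_le (σ.mono (mul_le_mul_right hB A))

theorem Invertible.ne_zero {A : FractionalIdeal D⁰ K} (h : σ.Invertible A) : A ≠ 0 := by
  rintro rfl
  rw [Invertible, zero_mul, σ.map_zero] at h
  exact zero_ne_one h

theorem Invertible.map_inv {A : FractionalIdeal D⁰ K} (h : σ.Invertible A) : σ A⁻¹ = A⁻¹ := by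
  refine le_antisymm ?_ (σ.le_map _)
  conv_rhs => rw [FractionalIdeal.inv_eq]
  rw [FractionalIdeal.le_div_iff_mul_le (h.ne_zero σ)]
  refine (σ.map_mul_le _ _).trans ?_
  rw [mul_comm]
  exact h.le

/-- `*`-Inv(D): the `*`-invertible fractional `*`-ideals. -/
def Inv : Type _ := {A : FractionalIdeal D⁰ K // σ.Invertible A ∧ σ A = A}

/-- `*`-Inv(D) is a group under `I * J = (IJ)_*`. -/
noncomputable instance : CommGroup σ.Inv where
  mul I J := ⟨σ (I.1 * J.1), by
    refine ⟨σ.invertible_of_mul (B := I.1⁻¹ * J.1⁻¹) ?_, σ.map_map _⟩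
    rw [σ.map_map_mul, mul_mul_mul_comm, ← σ.map_map_mul, I.2.1, one_mul, J.2.1]⟩
  one := ⟨1, σ.invertible_of_mul (B := 1) (by rw [one_mul, σ.map_one]), σ.map_one⟩
  inv I := ⟨I.1⁻¹, σ.invertible_of_mul (B := I.1) (by rw [mul_comm]; exact I.2.1),
    I.2.1.map_inv σ⟩
  mul_assoc I J L := Subtype.ext (by
    change σ (σ (I.1 * J.1) * L.1) = σ (I.1 * σ (J.1 * L.1))
    rw [σ.map_map_mul, σ.map_mul_map, mul_assoc])
  one_mul I := Subtype.ext (by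
    change σ (1 * I.1) = I.1
    rw [one_mul, I.2.2])
  mul_one I := Subtype.ext (by
    change σ (I.1 * 1) = I.1
    rw [mul_one, I.2.2])
  inv_mul_cancel I := Subtype.ext (by
    change σ (I.1⁻¹ * I.1) = 1
    rw [mul_comm]; exact I.2.1)
  mul_comm I J := Subtype.ext (by
    change σ (I.1 * J.1) = σ (J.1 * I.1)
    rw [mul_comm])

/-- Prin(D): the subgroup of nonzero principal fractional ideals. -/
def prin : Subgroup σ.Inv where
  carrier := {I | ∃ c : K, c ≠ 0 ∧ I.1 = FractionalIdeal.spanSingleton D⁰ c}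
  mul_mem' := by
    rintro I J ⟨c, hc, hI⟩ ⟨d, hd, hJ⟩
    refine ⟨c * d, mul_ne_zero hc hd, ?_⟩
    change σ (I.1 * J.1) = _
    rw [hI, hJ, FractionalIdeal.spanSingleton_mul_spanSingleton, σ.map_spanSingleton]
  one_mem' := ⟨1, one_ne_zero, FractionalIdeal.spanSingleton_one.symm⟩
  inv_mem' := by
    rintro I ⟨c, hc, hI⟩
    refine ⟨c⁻¹, inv_ne_zero hc, ?_⟩
    change I.1⁻¹ = _
    rw [hI, FractionalIdeal.spanSingleton_inv]

/-- The `*`-class group `Cl_*(D)`. -/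
abbrev ClassGroup : Type _ := σ.Inv ⧸ σ.prin

end StarOperation

/-! Everything is local at the maximal `*`-ideals. Finite character places every nonzero ideal with
proper closure inside a maximal `*`-ideal, so membership in `B_*` can be tested at each of them
(`mem_map_of_local`). That `D_P` is a DVR is expressed by elements of `D` (`IsLocalUniformizer`),
and `*`-invertible means locally principal.

If principal ideals are `*`-products of type 2 ideals, they are `*`-products of maximal `*`-ideals.
Each such `P` is then a `*`-factor of a principal ideal, hence `*`-invertible; a local generator of
`P` is a uniformizer, and `D` is `*`-Krull (`isKrullDomain_of_factorization`).

Conversely, in a `*`-Krull domain each `P` is the closure of a two-generated homogeneous ideal, and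
a `*`-invertible integral ideal is a `*`-product of powers of such ideals
(`Invertible.exists_prod_eq`). So the class group is torsion once each `P` has a power with
principal closure. Nonzero finitely generated ideals are `*`-invertible, and raising generators to
the `n`-th power has the same closure as raising the ideal (`map_span_pow`). Hence the AGCD, afg and
af conditions all amount to torsion, and condition 4 is the hub of the equivalence. -/

open scoped nonZeroDivisors

/-! ### Maximal `*`-ideals and the local test for membership in a closure -/

namespace StarOperation

variable {D K : Type*} [CommRing D] [IsDomain D] [Field K] [Algebra D K] [IsFractionRing D K]
variable {σ : StarOperation D K}

theorem coeIdeal_le_one (I : Ideal D) : σ (I : FractionalIdeal D⁰ K) ≤ 1 :=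
  (σ.mono FractionalIdeal.coeIdeal_le_one).trans_eq σ.map_one

theorem maxIdeals.ne_bot {P : Ideal D} (h : P ∈ σ.maxIdeals) : P ≠ ⊥ := h.1.1

theorem maxIdeals.ne_top {P : Ideal D} (h : P ∈ σ.maxIdeals) : P ≠ ⊤ := h.1.2.1

theorem maxIdeals.map_eq {P : Ideal D} (h : P ∈ σ.maxIdeals) :
    σ (P : FractionalIdeal D⁰ K) = P := h.1.2.2

theorem maxIdeals.eq_of_le {P Q : Ideal D} (hP : P ∈ σ.maxIdeals) (hQ : Q ∈ σ.maxIdeals)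
    (h : P ≤ Q) : P = Q :=
  le_antisymm h (hP.2 hQ.1 h)

theorem maxIdeals.map_le {P : Ideal D} (hP : P ∈ σ.maxIdeals) {I : Ideal D} (h : I ≤ P) :
    σ (I : FractionalIdeal D⁰ K) ≤ P :=
  (σ.mono (FractionalIdeal.coeIdeal_le_coeIdeal K |>.2 h)).trans_eq (maxIdeals.map_eq hP)

/-- A finitely generated ideal inside a directed union lies in one member, so finite character keeps
the union closed. This is the chain condition for Zorn's lemma. -/
theorem map_sSup_of_directedOn (hσ : σ.FiniteCharacter) {c : Set (Ideal D)} (hne : c.Nonempty)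
    (hc : DirectedOn (· ≤ ·) c) (h0 : sSup c ≠ ⊥)
    (h : ∀ I ∈ c, σ (I : FractionalIdeal D⁰ K) = I) :
    σ ((sSup c : Ideal D) : FractionalIdeal D⁰ K) = (sSup c : Ideal D) := by
  refine le_antisymm ?_ (σ.le_map _)
  intro x hx
  obtain ⟨B, -, hBfg, hB, hxB⟩ := (hσ _ (FractionalIdeal.coeIdeal_ne_zero.2 h0) x).1 hx
  obtain ⟨B, rfl⟩ := FractionalIdeal.le_one_iff_exists_coeIdeal.1
    (hB.trans FractionalIdeal.coeIdeal_le_one)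
  rw [FractionalIdeal.coeIdeal_fg _ (IsFractionRing.injective D K)] at hBfg
  rw [FractionalIdeal.coeIdeal_le_coeIdeal] at hB
  obtain ⟨I, hI, hBI⟩ := (CompleteLattice.isCompactElement_iff_le_of_directed_sSup_le (Ideal D) B).1
    ((Submodule.fg_iff_compact B).1 hBfg) c hne hc hB
  have h1 : σ (B : FractionalIdeal D⁰ K) ≤ I :=
    (σ.mono ((FractionalIdeal.coeIdeal_le_coeIdeal K).2 hBI)).trans_eq (h I hI)
  exact (FractionalIdeal.coeIdeal_le_coeIdeal K).2 (le_sSup hI) (h1 hxB)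

theorem exists_le_maxIdeals (hσ : σ.FiniteCharacter) {I : Ideal D} (hI : I ≠ ⊥)
    (h : σ (I : FractionalIdeal D⁰ K) ≠ 1) : ∃ P ∈ σ.maxIdeals, I ≤ P := by
  obtain ⟨J, hJ⟩ := FractionalIdeal.le_one_iff_exists_coeIdeal.1 (coeIdeal_le_one (σ := σ) I)
  have hIJ : I ≤ J := by
    rw [← FractionalIdeal.coeIdeal_le_coeIdeal K, hJ]
    exact σ.le_map _
  have hJ0 : J ≠ ⊥ := fun h0 => hI (le_bot_iff.1 (h0 ▸ hIJ))
  obtain ⟨P, hJP, hP⟩ := zorn_le_nonempty₀ {I : Ideal D | I ≠ ⊥ ∧ I ≠ ⊤ ∧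
    σ (I : FractionalIdeal D⁰ K) = (I : FractionalIdeal D⁰ K)} (by
      intro c hc hchain y hy
      have h0 : sSup c ≠ ⊥ := fun h0 => (hc hy).1 (le_bot_iff.1 (h0 ▸ le_sSup hy))
      refine ⟨sSup c, ⟨h0, ?_, ?_⟩, fun z hz => le_sSup hz⟩
      · rw [Ideal.ne_top_iff_one]
        intro h1
        obtain ⟨I, hI, h1⟩ := (Submodule.mem_sSup_of_directed ⟨y, hy⟩ hchain.directedOn).1 h1
        exact (hc hI).2.1 ((Ideal.eq_top_iff_one I).2 h1)
      · exact map_sSup_of_directedOn hσ ⟨y, hy⟩ hchain.directedOn h0 fun I hI => (hc hI).2.2)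
    J ⟨hJ0, by rintro rfl; exact h (by rw [← hJ]; simp), by rw [hJ, σ.map_map]⟩
  exact ⟨P, hP, hIJ.trans hJP⟩

/-- Membership in `B_*` can be tested at the maximal `*`-ideals. -/
theorem mem_map_of_local (hσ : σ.FiniteCharacter) {B : FractionalIdeal D⁰ K} (hB : B ≠ 0) {z : K}
    (h : ∀ P ∈ σ.maxIdeals, ∃ t : D, t ∉ P ∧ algebraMap D K t * z ∈ B) : z ∈ σ B := by
  -- The conductor of `z` into `B`. It lies in no maximal `*`-ideal, so `J_* = D`, and closing `zJ ⊆
  -- B` gives `z ∈ B_*`.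
  let J : Ideal D := (B : Submodule D K).comap (LinearMap.toSpanSingleton D K z)
  have hJ : ∀ d : D, d ∈ J ↔ algebraMap D K d * z ∈ B := fun d => by
    change d • z ∈ B ↔ _
    rw [Algebra.smul_def]
  by_cases hz : z = 0
  · subst hz; exact (σ B).zero_mem
  have hJ0 : J ≠ ⊥ := by
    obtain ⟨b, hb, hb0⟩ : ∃ b ∈ B, b ≠ 0 := by
      by_contra! hcon
      exact hB (FractionalIdeal.eq_zero_iff.2 hcon)
    obtain ⟨⟨n, d⟩, hd⟩ := IsLocalization.surj D⁰ (z / b)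
    have hbz : algebraMap D K d * z = algebraMap D K n * b := by
      simp only at hd
      field_simp at hd
      linear_combination hd
    intro h0
    have : (d : D) ∈ J := by
      rw [hJ, hbz, ← Algebra.smul_def]
      exact Submodule.smul_mem _ _ hb
    rw [h0, Ideal.mem_bot] at this
    exact nonZeroDivisors.coe_ne_zero d this
  have hJ1 : σ (J : FractionalIdeal D⁰ K) = 1 := by
    by_contra hne
    obtain ⟨P, hP, hJP⟩ := exists_le_maxIdeals hσ hJ0 hne
    obtain ⟨t, ht, htz⟩ := h P hP
    exact ht (hJP ((hJ t).2 htz))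
  have hle : FractionalIdeal.spanSingleton D⁰ z * (J : FractionalIdeal D⁰ K) ≤ B := by
    rw [FractionalIdeal.spanSingleton_mul_le_iff]
    intro y hy
    obtain ⟨d, hd, rfl⟩ := (FractionalIdeal.mem_coeIdeal _).1 hy
    rw [mul_comm]
    exact (hJ d).1 hd
  have h2 := σ.mono hle
  rw [← σ.map_mul_map, hJ1, mul_one, σ.map_spanSingleton] at h2
  exact h2 (FractionalIdeal.mem_spanSingleton_self _ _)

theorem map_le_map_of_local (hσ : σ.FiniteCharacter) {A B : Ideal D} (hB : B ≠ ⊥)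
    (h : ∀ P ∈ σ.maxIdeals, ∀ a ∈ A, ∃ t : D, t ∉ P ∧ t * a ∈ B) :
    σ (A : FractionalIdeal D⁰ K) ≤ σ (B : FractionalIdeal D⁰ K) := by
  rw [← σ.map_map (B : FractionalIdeal D⁰ K)]
  refine σ.mono fun z hz => ?_
  obtain ⟨a, ha, rfl⟩ := (FractionalIdeal.mem_coeIdeal _).1 hz
  refine mem_map_of_local hσ (FractionalIdeal.coeIdeal_ne_zero.2 hB) fun P hP => ?_
  obtain ⟨t, ht, hta⟩ := h P hP a ha
  exact ⟨t, ht, by rw [← map_mul]; exact FractionalIdeal.mem_coeIdeal_of_mem _ hta⟩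

/-- If `x, y ∉ P`, maximality makes the closures of `(P, x)` and `(P, y)` equal to `D`. Their
product lies in `P` when `xy ∈ P`, so `D ⊆ P_* = P`. -/
theorem maxIdeals.isPrime {P : Ideal D} (hP : P ∈ σ.maxIdeals) :
    P.IsPrime := by
  refine ⟨maxIdeals.ne_top hP, fun {x y} hxy => ?_⟩
  by_contra! hcon
  obtain ⟨hx, hy⟩ := hcon
  have key : ∀ z ∉ P, σ ((P ⊔ Ideal.span {z} : Ideal D) : FractionalIdeal D⁰ K) = 1 := by
    intro z hz
    obtain ⟨J, hJ⟩ := FractionalIdeal.le_one_iff_exists_coeIdeal.1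
      (coeIdeal_le_one (σ := σ) (P ⊔ Ideal.span {z}))
    have hle : P ⊔ Ideal.span {z} ≤ J := by
      rw [← FractionalIdeal.coeIdeal_le_coeIdeal K, hJ]
      exact σ.le_map _
    have hPJ : P ≤ J := le_sup_left.trans hle
    by_contra hne
    have := hP.2 (y := J) ⟨fun h0 => maxIdeals.ne_bot hP (le_bot_iff.1 (h0 ▸ hPJ)),
      by rintro rfl; exact hne (by rw [← hJ]; simp), by rw [hJ, σ.map_map]⟩ hPJ
    exact hz (this (hle (Ideal.mem_sup_right (Ideal.mem_span_singleton_self z))))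
  have hprod : (P ⊔ Ideal.span {x}) * (P ⊔ Ideal.span {y}) ≤ P := by
    rw [Ideal.mul_sup, Ideal.sup_mul, Ideal.sup_mul]
    refine sup_le (sup_le Ideal.mul_le_left Ideal.mul_le_right) (sup_le Ideal.mul_le_left ?_)
    rw [Ideal.span_singleton_mul_span_singleton, Ideal.span_singleton_le_iff_mem]
    exact hxy
  have h1 := maxIdeals.map_le hP hprod
  rw [FractionalIdeal.coeIdeal_mul, ← σ.map_map_mul, ← σ.map_mul_map, key x hx, key y hy, one_mul,
    σ.map_one] at h1
  refine maxIdeals.ne_top hP ?_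
  have h2 := le_antisymm FractionalIdeal.coeIdeal_le_one h1
  rw [FractionalIdeal.coeIdeal_eq_one] at h2
  rw [h2, Ideal.one_eq_top]

end StarOperation

/-- `π ∈ P` and every nonzero `x` is a power of `π` up to units of `D_P`. -/
structure IsLocalUniformizer {D : Type*} [CommRing D] (P : Ideal D) (π : D) : Prop where
  ne_zero : π ≠ 0
  mem : π ∈ P
  exists_mul_eq : ∀ x : D, x ≠ 0 → ∃ (n : ℕ) (t u : D), t ∉ P ∧ u ∉ P ∧ t * x = u * π ^ n

/-! ### Discrete valuation rings `D_P` through elements of `D` -/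

namespace IsLocalUniformizer

variable {D : Type*} [CommRing D] {P : Ideal D} {π : D}

theorem exists_dvd_mul (h : IsLocalUniformizer P π) {q : D} (hq : q ∈ P) :
    ∃ t ∉ P, π ∣ t * q := by
  by_cases h0 : q = 0
  -- `P` is not assumed proper here; factoring `π` itself supplies an element outside `P`.
  · obtain ⟨-, t, -, ht, -, -⟩ := h.exists_mul_eq π h.ne_zero
    exact ⟨t, ht, by simp [h0]⟩
  obtain ⟨n, t, u, ht, hu, htu⟩ := h.exists_mul_eq q h0
  refine ⟨t, ht, ?_⟩
  rcases n with _ | n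
  · rw [pow_zero, mul_one] at htu
    exact absurd (htu ▸ P.mul_mem_left t hq) hu
  · rw [htu, pow_succ, ← mul_assoc]
    exact dvd_mul_left _ _

theorem exists_mul_dvd_or (h : IsLocalUniformizer P π) [hP : P.IsPrime] (a b : D) :
    (∃ t ∉ P, a ∣ t * b) ∨ ∃ t ∉ P, b ∣ t * a := by
  by_cases ha : a = 0
  · exact Or.inr ⟨1, hP.one_notMem, by simp [ha]⟩
  by_cases hb : b = 0
  · exact Or.inl ⟨1, hP.one_notMem, by simp [hb]⟩
  obtain ⟨n, t, u, ht, hu, hn⟩ := h.exists_mul_eq a ha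
  obtain ⟨m, t', u', ht', hu', hm⟩ := h.exists_mul_eq b hb
  rcases le_total n m with hle | hle
  · obtain ⟨k, rfl⟩ := Nat.exists_eq_add_of_le hle
    exact Or.inl ⟨u * t', hP.mul_notMem hu ht', u' * π ^ k * t, by
      linear_combination u * hm - u' * π ^ k * hn⟩
  · obtain ⟨k, rfl⟩ := Nat.exists_eq_add_of_le hle
    exact Or.inr ⟨u' * t, hP.mul_notMem hu' ht, u * π ^ k * t', by
      linear_combination u' * hn - u * π ^ k * hm⟩

theorem exists_forall_dvd_mul (h : IsLocalUniformizer P π) [hP : P.IsPrime] {s : Finset D}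
    (hs : s.Nonempty) : ∃ a ∈ s, ∃ t ∉ P, ∀ b ∈ s, a ∣ t * b := by
  classical
  induction hs using Finset.Nonempty.cons_induction with
  | singleton a => exact ⟨a, by simp, 1, hP.one_notMem, by simp⟩
  | cons b s hb _ ih =>
    obtain ⟨a, ha, t, ht, hab⟩ := ih
    rcases h.exists_mul_dvd_or a b with ⟨u, hu, hd⟩ | ⟨u, hu, hd⟩
    · refine ⟨a, by simp [ha], u * t, hP.mul_notMem hu ht, ?_⟩
      intro c hc
      rcases Finset.mem_cons.1 hc with rfl | hc
      · rw [mul_right_comm]; exact hd.mul_right t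
      · rw [mul_assoc]; exact (hab c hc).mul_left u
    · refine ⟨b, by simp, u * t, hP.mul_notMem hu ht, ?_⟩
      intro c hc
      rcases Finset.mem_cons.1 hc with rfl | hc
      · exact dvd_mul_left _ _
      · rw [mul_assoc]; exact hd.trans (mul_dvd_mul_left u (hab c hc))

/-- A nonzero element of `R` yields some `u * π ^ n ∈ R` with `u ∉ P`, so `π ∈ R`; and `π` generates
`P` locally. -/
theorem eq_of_le (h : IsLocalUniformizer P π) {R : Ideal D} (hR : R.IsPrime) (h0 : R ≠ ⊥)
    (hle : R ≤ P) : R = P := by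
  refine le_antisymm hle fun q hq => ?_
  obtain ⟨x, hx, hx0⟩ := Submodule.exists_mem_ne_zero_of_ne_bot h0
  obtain ⟨n, t, u, ht, hu, htu⟩ := h.exists_mul_eq x hx0
  have hπ : π ∈ R := by
    have : u * π ^ n ∈ R := htu ▸ R.mul_mem_left t hx
    exact hR.mem_of_pow_mem n ((hR.mem_or_mem this).resolve_left fun h => hu (hle h))
  obtain ⟨t, ht, hd⟩ := h.exists_dvd_mul hq
  exact (hR.mem_or_mem (R.mem_of_dvd hd hπ)).resolve_left fun h => ht (hle h)

theorem height_eq_one [IsDomain D] (h : IsLocalUniformizer P π) [hP : P.IsPrime] :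
    P.height = 1 := by
  have h0 : P ≠ ⊥ := fun h0 => h.ne_zero (by simpa [h0] using h.mem)
  refine le_antisymm ?_ ?_
  · rw [← Nat.cast_one, Ideal.height_le_iff]
    intro q hq hlt
    by_cases hq0 : q = ⊥
    · simp [hq0]
    · exact absurd (h.eq_of_le hq hq0 hlt.le) hlt.ne
  · rw [Order.one_le_iff_ne_zero]
    exact fun h1 => h0 (Ideal.height_eq_zero_iff_eq_bot.1 h1)

theorem isDiscreteValuationRing [IsDomain D] (h : IsLocalUniformizer P π) [hP : P.IsPrime] :
    IsDiscreteValuationRing (Localization.AtPrime P) := by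
  let f := algebraMap D (Localization.AtPrime P)
  have hinj : Function.Injective f :=
    IsLocalization.injective _ P.primeCompl_le_nonZeroDivisors
  have hunit : ∀ x, IsUnit (f x) ↔ x ∉ P := fun x =>
    IsLocalization.AtPrime.isUnit_to_map_iff (Localization.AtPrime P) P x
  have hfac : ∀ x : Localization.AtPrime P, x ≠ 0 → ∃ n, Associated (f π ^ n) x := by
    intro x hx
    obtain ⟨⟨a, s⟩, hs⟩ := IsLocalization.surj P.primeCompl x
    replace hs : x * f s = f a := hs
    have hsu : IsUnit (f s) := (hunit s).2 s.2
    have ha : a ≠ 0 := by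
      rintro rfl
      rw [_root_.map_zero] at hs
      exact hx ((hsu.mul_left_eq_zero).1 hs)
    obtain ⟨n, t, u, ht, hu, htu⟩ := h.exists_mul_eq a ha
    refine ⟨n, ?_⟩
    have h1 : f t * (x * f s) = f u * f π ^ n := by
      rw [hs, ← map_mul, htu, map_mul, map_pow]
    have h2 : Associated (f u * f π ^ n) (f π ^ n) :=
      associated_unit_mul_left _ _ ((hunit u).2 hu)
    have h3 : Associated (f t * (x * f s)) x :=
      (associated_unit_mul_left _ _ ((hunit t).2 ht)).trans (associated_mul_unit_left _ _ hsu)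
    exact h2.symm.trans (h1 ▸ h3)
  have hnu : ¬ IsUnit (f π) := fun hu => (hunit π).1 hu h.mem
  have hne : f π ≠ 0 := fun h0 => h.ne_zero (hinj (by rw [h0, _root_.map_zero]))
  refine IsDiscreteValuationRing.ofHasUnitMulPowIrreducibleFactorization
    ⟨f π, ⟨hnu, fun a b hab => ?_⟩, fun {x} => hfac x⟩
  obtain ⟨n, hn⟩ := hfac a (by rintro rfl; exact hne (by rw [hab, zero_mul]))
  obtain ⟨m, hm⟩ := hfac b (by rintro rfl; exact hne (by rw [hab, mul_zero]))
  rcases n with _ | n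
  · exact Or.inl (associated_one_iff_isUnit.1 (by simpa using hn.symm))
  rcases m with _ | m
  · exact Or.inr (associated_one_iff_isUnit.1 (by simpa using hm.symm))
  exfalso
  -- Both factors are divisible by `π`, so `π ^ 2` divides `π` in `D_P` and `π` would be a unit.
  obtain ⟨c, hc⟩ := (hn.mul_mul hm).dvd.trans (dvd_of_eq hab.symm)
  refine hnu (IsUnit.of_mul_eq_one (f π ^ (n + m) * f π ^ 0 * c) (mul_left_cancel₀ hne ?_))
  rw [mul_one]
  conv_rhs => rw [hc]
  ring

theorem exists_of_isDiscreteValuationRing [IsDomain D] (P : Ideal D) [hP : P.IsPrime]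
    [IsDiscreteValuationRing (Localization.AtPrime P)] : ∃ π, IsLocalUniformizer P π := by
  let f := algebraMap D (Localization.AtPrime P)
  have hinj : Function.Injective f :=
    IsLocalization.injective _ P.primeCompl_le_nonZeroDivisors
  have hunit : ∀ x, IsUnit (f x) ↔ x ∉ P := fun x =>
    IsLocalization.AtPrime.isUnit_to_map_iff (Localization.AtPrime P) P x
  obtain ⟨ϖ, hϖ⟩ := IsDiscreteValuationRing.exists_irreducible (Localization.AtPrime P)
  obtain ⟨⟨π, s⟩, hs⟩ := IsLocalization.surj P.primeCompl ϖ
  replace hs : ϖ * f s = f π := hs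
  have hsu : IsUnit (f s) := (hunit s).2 s.2
  refine ⟨π, ?_, ?_, ?_⟩
  · rintro rfl
    rw [_root_.map_zero] at hs
    exact hϖ.ne_zero ((hsu.mul_left_eq_zero).1 hs)
  · by_contra hπ
    have := (hunit π).2 hπ
    rw [← hs] at this
    exact hϖ.not_isUnit (isUnit_of_mul_isUnit_left this)
  · intro x hx
    have hfx : f x ≠ 0 := fun h => hx (hinj (by rw [h, _root_.map_zero]))
    obtain ⟨n, v, hv⟩ := IsDiscreteValuationRing.eq_unit_mul_pow_irreducible hfx hϖ
    obtain ⟨⟨u, t⟩, hut⟩ := IsLocalization.surj P.primeCompl (v : Localization.AtPrime P)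
    replace hut : (v : Localization.AtPrime P) * f t = f u := hut
    -- With `x = v * ϖ ^ n` in `D_P`, `t` clears the denominator of the unit `v` and `s ^ n` that of
    -- `ϖ ^ n`.
    refine ⟨n, t * s ^ n, u, hP.mul_notMem t.2 fun h => s.2 (hP.mem_of_pow_mem n h), ?_, hinj ?_⟩
    · rw [← hunit, ← hut]
      exact v.isUnit.mul ((hunit t).2 t.2)
    · rw [map_mul, map_mul, map_mul, map_pow, map_pow, hv, ← hut, ← hs]
      ring

end IsLocalUniformizer

/-! ### `*`-invertible ideals: local principality and factorization -/

namespace StarOperation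

variable {D K : Type*} [CommRing D] [IsDomain D] [Field K] [Algebra D K] [IsFractionRing D K]
variable {σ : StarOperation D K}

/-- Since `P` is closed, `A * A⁻¹` is not inside `P`: some `t = y * a` with `a ∈ A`, `y ∈ A⁻¹`
avoids `P`. Then `t * b = a * (y * b)` with `y * b ∈ D`. -/
theorem Invertible.exists_dvd_mul {A : Ideal D} (hA : σ.Invertible (A : FractionalIdeal D⁰ K))
    {P : Ideal D} (hP : P ∈ σ.maxIdeals) :
    ∃ a ∈ A, a ≠ 0 ∧ ∃ t ∉ P, ∀ b ∈ A, a ∣ t * b := by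
  have hA0 := hA.ne_zero σ
  have h1 : ¬ (A : FractionalIdeal D⁰ K) * (A : FractionalIdeal D⁰ K)⁻¹ ≤ P := fun h => by
    have h2 := (σ.mono h).trans_eq (maxIdeals.map_eq hP)
    rw [hA] at h2
    have h3 := le_antisymm FractionalIdeal.coeIdeal_le_one h2
    rw [FractionalIdeal.coeIdeal_eq_one] at h3
    exact maxIdeals.ne_top hP (by rw [h3, Ideal.one_eq_top])
  rw [FractionalIdeal.mul_le] at h1
  push Not at h1
  obtain ⟨i, hi, y, hy, hyi⟩ := h1
  obtain ⟨a, ha, rfl⟩ := (FractionalIdeal.mem_coeIdeal _).1 hi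
  have hmul : ∀ b ∈ A, ∃ d : D, algebraMap D K d = y * algebraMap D K b := fun b hb =>
    (FractionalIdeal.mem_one_iff _).1
      ((FractionalIdeal.mem_inv_iff hA0).1 hy _ (FractionalIdeal.mem_coeIdeal_of_mem _ hb))
  obtain ⟨t, ht⟩ := hmul a ha
  have htP : t ∉ P := fun h => hyi (by
    rw [mul_comm, ← ht]
    exact FractionalIdeal.mem_coeIdeal_of_mem _ h)
  refine ⟨a, ha, ?_, t, htP, fun b hb => ?_⟩
  · rintro rfl
    rw [_root_.map_zero, mul_zero, FaithfulSMul.algebraMap_eq_zero_iff] at ht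
    exact htP (ht ▸ P.zero_mem)
  · obtain ⟨d, hd⟩ := hmul b hb
    refine ⟨d, IsFractionRing.injective D K ?_⟩
    rw [map_mul, map_mul, ht, hd]
    ring

/-- The local data put `t / a` in `A⁻¹`, so `A * A⁻¹` contains an element outside each `P`, and the
local test applies to `1`. -/
theorem invertible_of_local (hσ : σ.FiniteCharacter) {A : Ideal D} (hA0 : A ≠ ⊥)
    (h : ∀ P ∈ σ.maxIdeals, ∃ a ∈ A, a ≠ 0 ∧ ∃ t ∉ P, ∀ b ∈ A, a ∣ t * b) :
    σ.Invertible (A : FractionalIdeal D⁰ K) := by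
  have hA0' : (A : FractionalIdeal D⁰ K) ≠ 0 := FractionalIdeal.coeIdeal_ne_zero.2 hA0
  refine le_antisymm ((σ.mono FractionalIdeal.mul_one_div_le_one).trans_eq σ.map_one) ?_
  rw [FractionalIdeal.one_le]
  have hone : 1 ≤ (A : FractionalIdeal D⁰ K)⁻¹ := by
    rw [FractionalIdeal.one_le, FractionalIdeal.mem_inv_iff hA0']
    exact fun y hy => by rw [one_mul]; exact FractionalIdeal.coeIdeal_le_one hy
  have hne : (A : FractionalIdeal D⁰ K) * (A : FractionalIdeal D⁰ K)⁻¹ ≠ 0 := fun h0 => by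
    have h1 := mul_le_mul_right hone (A : FractionalIdeal D⁰ K)
    rw [mul_one, h0] at h1
    exact hA0' (le_antisymm h1 (FractionalIdeal.zero_le _))
  refine mem_map_of_local hσ hne fun P hP => ?_
  obtain ⟨a, ha, ha0, t, ht, hd⟩ := h P hP
  have ha0' : algebraMap D K a ≠ 0 := by simpa using ha0
  refine ⟨t, ht, ?_⟩
  have hy : algebraMap D K t / algebraMap D K a ∈ (A : FractionalIdeal D⁰ K)⁻¹ := by
    rw [FractionalIdeal.mem_inv_iff hA0']
    intro y hy
    obtain ⟨b, hb, rfl⟩ := (FractionalIdeal.mem_coeIdeal _).1 hy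
    obtain ⟨d, hd⟩ := hd b hb
    refine (FractionalIdeal.mem_one_iff _).2 ⟨d, ?_⟩
    rw [div_mul_eq_mul_div, eq_div_iff ha0', ← map_mul, ← map_mul, hd, mul_comm]
  have := FractionalIdeal.mul_mem_mul (FractionalIdeal.mem_coeIdeal_of_mem D⁰ ha) hy
  rwa [mul_div_cancel₀ _ ha0', ← mul_one (algebraMap D K t)] at this

theorem exists_forall_dvd_mul_of_span {P : Ideal D} [P.IsPrime] {π : D}
    (hπ : IsLocalUniformizer P π) {s : Finset D} (h0 : Ideal.span (s : Set D) ≠ ⊥) :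
    ∃ a ∈ s, a ≠ 0 ∧ ∃ t ∉ P, ∀ b ∈ Ideal.span (s : Set D), a ∣ t * b := by
  have hs : s.Nonempty := by
    rw [Finset.nonempty_iff_ne_empty]
    rintro rfl
    simp at h0
  obtain ⟨a, ha, t, ht, hd⟩ := hπ.exists_forall_dvd_mul hs
  have hall : ∀ b ∈ Ideal.span (s : Set D), a ∣ t * b := fun b hb => by
    induction hb using Submodule.span_induction with
    | mem x hx => exact hd x hx
    | zero => simp
    | add x y _ _ hx hy => rw [mul_add]; exact dvd_add hx hy
    | smul r x _ hx => rw [smul_eq_mul, mul_left_comm]; exact hx.mul_left r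
  refine ⟨a, ha, ?_, t, ht, hall⟩
  rintro rfl
  refine h0 (Ideal.span_eq_bot.2 fun b hb => ?_)
  have := zero_dvd_iff.1 (hd b hb)
  exact (mul_eq_zero.1 this).resolve_left fun h => ht (h ▸ P.zero_mem)

theorem invertible_of_fg (hσ : σ.FiniteCharacter)
    (hU : ∀ P ∈ σ.maxIdeals, ∃ π, IsLocalUniformizer P π) {A : Ideal D} (hA : A.FG)
    (hA0 : A ≠ ⊥) : σ.Invertible (A : FractionalIdeal D⁰ K) := by
  refine invertible_of_local hσ hA0 fun P hP => ?_
  obtain ⟨s, rfl⟩ := hA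
  obtain ⟨π, hπ⟩ := hU P hP
  have := maxIdeals.isPrime hP
  obtain ⟨a, ha, h⟩ := exists_forall_dvd_mul_of_span hπ hA0
  exact ⟨a, Ideal.subset_span ha, h⟩

/-- At each `P` one generator `b i` divides all the others locally, so both ideals are locally
generated by `b i ^ n`. This converts powers of elements into powers of ideals. -/
theorem map_span_pow (hσ : σ.FiniteCharacter)
    (hU : ∀ P ∈ σ.maxIdeals, ∃ π, IsLocalUniformizer P π) {ι : Type*} [Finite ι] (b : ι → D)
    (h0 : Ideal.span (Set.range b) ≠ ⊥) (n : ℕ) :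
    σ ((Ideal.span (Set.range fun i => b i ^ n) : Ideal D) : FractionalIdeal D⁰ K) =
      σ ((Ideal.span (Set.range b) : Ideal D) ^ n : FractionalIdeal D⁰ K) := by
  rw [← FractionalIdeal.coeIdeal_pow]
  refine le_antisymm (σ.mono ((FractionalIdeal.coeIdeal_le_coeIdeal K).2 ?_)) ?_
  · rw [Ideal.span_le]
    rintro _ ⟨i, rfl⟩
    exact Ideal.pow_mem_pow (Ideal.subset_span (Set.mem_range_self i)) n
  refine map_le_map_of_local hσ ?_ fun P hP z hz => ?_
  · rw [Ne, Ideal.span_eq_bot]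
    intro h
    refine h0 (Ideal.span_eq_bot.2 ?_)
    rintro _ ⟨i, rfl⟩
    exact eq_zero_of_pow_eq_zero (h _ (Set.mem_range_self i))
  · have := maxIdeals.isPrime hP
    obtain ⟨π, hπ⟩ := hU P hP
    have hfin := Set.finite_range b
    obtain ⟨a, ha, -, t, ht, hd⟩ := exists_forall_dvd_mul_of_span (s := hfin.toFinset) hπ
      (by rwa [Set.Finite.coe_toFinset])
    rw [Set.Finite.coe_toFinset] at hd
    obtain ⟨i, rfl⟩ := hfin.mem_toFinset.1 ha
    refine ⟨t ^ n, fun h => ht (this.mem_of_pow_mem n h), ?_⟩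
    have hle : Ideal.span {t} * Ideal.span (Set.range b) ≤ Ideal.span {b i} := by
      rw [Ideal.span_singleton_mul_le_iff]
      exact fun c hc => Ideal.mem_span_singleton.2 (hd c hc)
    have hpow := Ideal.pow_right_mono hle n
    rw [mul_pow, Ideal.span_singleton_pow, Ideal.span_singleton_pow] at hpow
    refine Ideal.span_mono ?_ (hpow (Ideal.mul_mem_mul (Ideal.mem_span_singleton_self _) hz))
    exact Set.singleton_subset_iff.2 ⟨i, rfl⟩

/-- Every maximal `*`-ideal is `*`-generated by two elements. -/
theorem exists_isHomogeneousAt_span_pair (hσ : σ.FiniteCharacter)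
    (hfin : ∀ x : D, x ≠ 0 → ¬ IsUnit x → {P ∈ σ.maxIdeals | x ∈ P}.Finite)
    {P : Ideal D} (hP : P ∈ σ.maxIdeals) {π : D} (hπ : IsLocalUniformizer P π) :
    ∃ b : D, b ≠ 0 ∧ σ.IsHomogeneousAt (Ideal.span {π, b}) P ∧
      σ ((Ideal.span {π, b} : Ideal D) : FractionalIdeal D⁰ K) = P := by
  classical
  have hPp := maxIdeals.isPrime hP
  have hS := hfin π hπ.ne_zero fun hu => hPp.ne_top (Ideal.eq_top_of_isUnit_mem _ hπ.mem hu)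
  -- Prime avoidance will choose `b ∈ P` outside every other maximal `*`-ideal containing `π`;
  -- including `⊥` forces `b ≠ 0`.
  let F : Finset (Ideal D) := insert ⊥ (hS.toFinset.erase P)
  have hF : ∀ Q ∈ F, Q = ⊥ ∨ (Q ≠ P ∧ Q ∈ σ.maxIdeals ∧ π ∈ Q) := by
    intro Q hQ
    rcases Finset.mem_insert.1 hQ with rfl | hQ
    · exact Or.inl rfl
    · rw [Finset.mem_erase, hS.mem_toFinset] at hQ
      exact Or.inr hQ
  obtain ⟨b, hbP, hb⟩ : ∃ b ∈ P, ∀ Q ∈ F, b ∉ Q := by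
    by_contra! hcon
    obtain ⟨Q, hQ, hle⟩ := (Ideal.subset_union_prime (s := F) (f := id) (I := P) ⊥ ⊥ (by
      intro Q hQ _ _
      rcases hF Q hQ with rfl | h
      · exact Ideal.isPrime_bot
      · exact maxIdeals.isPrime h.2.1)).1 (by
      intro x hx
      obtain ⟨Q, hQ, hxQ⟩ := hcon x hx
      exact Set.mem_biUnion (Finset.mem_coe.2 hQ) hxQ)
    rcases hF Q hQ with rfl | h
    · exact maxIdeals.ne_bot hP (le_bot_iff.1 hle)
    · exact h.1 (maxIdeals.eq_of_le hP h.2.1 hle).symm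
  have hb0 : b ≠ 0 := fun h => hb ⊥ (Finset.mem_insert_self _ _) (by simp [h])
  have hπB : π ∈ Ideal.span ({π, b} : Set D) := Ideal.subset_span (by simp)
  have hbB : b ∈ Ideal.span ({π, b} : Set D) := Ideal.subset_span (by simp)
  have hB0 : Ideal.span ({π, b} : Set D) ≠ ⊥ := fun h => hπ.ne_zero (by simpa [h] using hπB)
  have hBP : Ideal.span ({π, b} : Set D) ≤ P := by
    rw [Ideal.span_le]
    rintro x (rfl | rfl)
    exacts [hπ.mem, hbP]
  have hbQ : ∀ Q ∈ σ.maxIdeals, π ∈ Q → Q ≠ P → b ∉ Q := fun Q hQ hπQ hne =>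
    hb Q (Finset.mem_insert_of_mem (Finset.mem_erase.2 ⟨hne, hS.mem_toFinset.2 ⟨hQ, hπQ⟩⟩))
  refine ⟨b, hb0, ⟨hB0, Submodule.fg_span (Set.toFinite _), hP, hBP, fun Q hQ hle => ?_⟩, ?_⟩
  · by_contra hne
    exact hbQ Q hQ (hle hπB) hne (hle hbB)
  · refine le_antisymm (maxIdeals.map_le hP hBP) ((σ.le_map _).trans ?_)
    refine map_le_map_of_local hσ hB0 fun Q hQ q hq => ?_
    -- At `P` the element `π` generates; at any other `Q`, one of `b`, `π` is a local unit.
    by_cases hQP : Q = P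
    · subst hQP
      obtain ⟨t, ht, hd⟩ := hπ.exists_dvd_mul hq
      exact ⟨t, ht, Ideal.mem_of_dvd _ hd hπB⟩
    by_cases hπQ : π ∈ Q
    · exact ⟨b, hbQ Q hQ hπQ hQP, Ideal.mul_mem_right _ _ hbB⟩
    · exact ⟨π, hπQ, Ideal.mul_mem_right _ _ hπB⟩

theorem map_pow_eq_of_map_eq {A B : FractionalIdeal D⁰ K} (h : σ A = σ B) (n : ℕ) :
    σ (A ^ n) = σ (B ^ n) := by
  induction n with
  | zero => simp
  | succ n ih => rw [pow_succ, pow_succ, ← σ.map_map_mul, ih, σ.map_map_mul, ← σ.map_mul_map, h,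
      σ.map_mul_map]

theorem IsHomogeneousAt.pow {A P : Ideal D} (h : σ.IsHomogeneousAt A P) {n : ℕ} (hn : n ≠ 0) :
    σ.IsHomogeneousAt (A ^ n) P where
  ne_bot := pow_ne_zero n h.ne_bot
  fg := Submodule.FG.pow h.fg n
  mem := h.mem
  le := (Ideal.pow_le_self hn).trans h.le
  unique Q hQ hle := h.unique Q hQ ((maxIdeals.isPrime hQ).le_of_pow_le hle)

/-- `P ^ n` need not be finitely generated, so the `P`-component of `I` is taken to be `(π, b) ^ n`,
with `n` the order at `P` of a local generator of `I`. The last two clauses say that `I` and `C`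
agree in `D_P`. -/
theorem Invertible.exists_isHomogeneousAt (hσ : σ.FiniteCharacter)
    (hU : ∀ P ∈ σ.maxIdeals, ∃ π, IsLocalUniformizer P π)
    (hfin : ∀ x : D, x ≠ 0 → ¬ IsUnit x → {P ∈ σ.maxIdeals | x ∈ P}.Finite)
    {I : Ideal D} (hI : σ.Invertible (I : FractionalIdeal D⁰ K))
    {P : Ideal D} (hP : P ∈ σ.maxIdeals) (hIP : I ≤ P) :
    ∃ C : Ideal D, σ.IsHomogeneousAt C P ∧ (∃ n : ℕ, 1 ≤ n ∧
      σ (C : FractionalIdeal D⁰ K) = σ ((P ^ n : Ideal D) : FractionalIdeal D⁰ K)) ∧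
      (∀ z ∈ I, ∃ t ∉ P, t * z ∈ C) ∧ ∀ z ∈ C, ∃ t ∉ P, t * z ∈ I := by
  have hPp := maxIdeals.isPrime hP
  obtain ⟨π, hπ⟩ := hU P hP
  obtain ⟨b, -, hB, hBσ⟩ := exists_isHomogeneousAt_span_pair hσ hfin hP hπ
  obtain ⟨a, haI, ha0, t, ht, hd⟩ := hI.exists_dvd_mul hP
  obtain ⟨n, s, u, hs, hu, hsu⟩ := hπ.exists_mul_eq a ha0
  have hn : n ≠ 0 := by
    rintro rfl
    rw [pow_zero, mul_one] at hsu
    exact hu (hsu ▸ P.mul_mem_left s (hIP haI))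
  refine ⟨_, hB.pow hn, ⟨n, Nat.one_le_iff_ne_zero.2 hn, ?_⟩, fun z hz => ?_, fun z hz => ?_⟩
  · rw [FractionalIdeal.coeIdeal_pow, FractionalIdeal.coeIdeal_pow]
    exact map_pow_eq_of_map_eq (by rw [hBσ, maxIdeals.map_eq hP]) n
  · obtain ⟨c, hc⟩ := hd z hz
    refine ⟨s * t, hPp.mul_notMem hs ht, ?_⟩
    have h1 : s * t * z = c * u * π ^ n := by linear_combination s * hc + c * hsu
    rw [h1]
    exact Ideal.mul_mem_left _ _ (Ideal.pow_mem_pow (Ideal.subset_span (by simp)) n)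
  · obtain ⟨v, hv, hdv⟩ := hπ.exists_dvd_mul (hB.le (Ideal.subset_span (by simp : b ∈ _)))
    have hle : Ideal.span {v} * Ideal.span {π, b} ≤ Ideal.span {π} := by
      rw [Ideal.span_mul_span', Ideal.span_le]
      rintro _ ⟨x, rfl, y, rfl | rfl, rfl⟩
      · exact Ideal.mem_span_singleton.2 (dvd_mul_left _ _)
      · exact Ideal.mem_span_singleton.2 hdv
    have hpow := Ideal.pow_right_mono hle n
    rw [mul_pow, Ideal.span_singleton_pow, Ideal.span_singleton_pow] at hpow
    obtain ⟨c, hc⟩ := Ideal.mem_span_singleton.1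
      (hpow (Ideal.mul_mem_mul (Ideal.mem_span_singleton_self _) hz))
    refine ⟨u * v ^ n, hPp.mul_notMem hu fun h => hv (hPp.mem_of_pow_mem n h), ?_⟩
    have h1 : u * v ^ n * z = c * s * a := by linear_combination u * hc - c * hsu
    rw [h1]
    exact Ideal.mul_mem_left _ _ haI

/-- Only finitely many `P` contain `I`. The product of the components agrees with `I` at each of
these, since the other factors are locally trivial there; elsewhere both are locally trivial. -/
theorem Invertible.exists_prod_eq (hσ : σ.FiniteCharacter)
    (hU : ∀ P ∈ σ.maxIdeals, ∃ π, IsLocalUniformizer P π)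
    (hfin : ∀ x : D, x ≠ 0 → ¬ IsUnit x → {P ∈ σ.maxIdeals | x ∈ P}.Finite)
    {I : Ideal D} (hI : σ.Invertible (I : FractionalIdeal D⁰ K)) :
    σ.IsStarProductOf σ.IsType2Homogeneous (σ (I : FractionalIdeal D⁰ K)) := by
  classical
  have hI0 : I ≠ ⊥ := FractionalIdeal.coeIdeal_ne_zero.1 (hI.ne_zero σ)
  have hS : {P ∈ σ.maxIdeals | I ≤ P}.Finite := by
    obtain ⟨x, hx, hx0⟩ := Submodule.exists_mem_ne_zero_of_ne_bot hI0
    by_cases hu : IsUnit x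
    · refine Set.finite_empty.subset fun P hP => ?_
      exact maxIdeals.ne_top hP.1 (Ideal.eq_top_of_isUnit_mem _ (hP.2 hx) hu)
    · exact (hfin x hx0 hu).subset fun P hP => ⟨hP.1, hP.2 hx⟩
  have key : ∀ P : Ideal D, ∃ C : Ideal D, P ∈ hS.toFinset → σ.IsHomogeneousAt C P ∧ (∃ n : ℕ,
      1 ≤ n ∧ σ (C : FractionalIdeal D⁰ K) = σ ((P ^ n : Ideal D) : FractionalIdeal D⁰ K)) ∧
      (∀ z ∈ I, ∃ t ∉ P, t * z ∈ C) ∧ ∀ z ∈ C, ∃ t ∉ P, t * z ∈ I := by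
    intro P
    by_cases hP : P ∈ hS.toFinset
    · have hP' := hS.mem_toFinset.1 hP
      obtain ⟨C, hC⟩ := Invertible.exists_isHomogeneousAt hσ hU hfin hI hP'.1 hP'.2
      exact ⟨C, fun _ => hC⟩
    -- A default value for `P` not containing `I`, never used in the product.
    · exact ⟨⊥, fun h => absurd h hP⟩
  choose C hC using key
  have hnot : ∀ Q ∈ σ.maxIdeals, ∀ F ⊆ hS.toFinset, Q ∉ F → ∃ u ∈ ∏ P ∈ F, C P, u ∉ Q := by
    intro Q hQ F hF hQF
    refine Set.not_subset.1 fun hle => ?_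
    obtain ⟨P, hP, hPQ⟩ := (maxIdeals.isPrime hQ).prod_le.1 hle
    exact hQF ((hC P (hF hP)).1.unique Q hQ hPQ ▸ hP)
  refine ⟨hS.toFinset.val.map C, ?_, ?_⟩
  · intro A hA
    obtain ⟨P, hP, rfl⟩ := Multiset.mem_map.1 hA
    exact ⟨P, (hC P hP).1, (hC P hP).2.1⟩
  change _ = σ ((∏ P ∈ hS.toFinset, C P : Ideal D) : FractionalIdeal D⁰ K)
  refine le_antisymm (map_le_map_of_local hσ ?_ ?_) (map_le_map_of_local hσ hI0 ?_)
  · exact Finset.prod_ne_zero_iff.2 fun P hP => (hC P hP).1.ne_bot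
  · intro Q hQ z hz
    by_cases hQF : Q ∈ hS.toFinset
    · obtain ⟨u, hu, huQ⟩ := hnot Q hQ _ (Finset.erase_subset Q _) (Finset.notMem_erase Q _)
      obtain ⟨t, ht, htz⟩ := (hC Q hQF).2.2.1 z hz
      refine ⟨t * u, (maxIdeals.isPrime hQ).mul_notMem ht huQ, ?_⟩
      rw [← Finset.mul_prod_erase _ _ hQF, mul_right_comm]
      exact Ideal.mul_mem_mul htz hu
    · obtain ⟨u, hu, huQ⟩ := hnot Q hQ _ subset_rfl hQF
      exact ⟨u, huQ, Ideal.mul_mem_right _ _ hu⟩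
  · intro Q hQ z hz
    by_cases hQF : Q ∈ hS.toFinset
    · refine (hC Q hQF).2.2.2 z ?_
      rw [← Finset.mul_prod_erase _ _ hQF] at hz
      exact Ideal.mul_le_left hz
    · obtain ⟨u, hu, huQ⟩ := Set.not_subset.1 fun hle => hQF (hS.mem_toFinset.2 ⟨hQ, hle⟩)
      exact ⟨u, huQ, Ideal.mul_mem_right _ _ hu⟩

/-! ### Powers with principal closure and torsion of the class group -/

theorem Invertible.map {A : FractionalIdeal D⁰ K} (h : σ.Invertible A) : σ.Invertible (σ A) :=
  σ.invertible_of_mul (B := A⁻¹) (by rw [σ.map_map_mul]; exact h)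

theorem Invertible.of_map_mul_eq {A B C : FractionalIdeal D⁰ K} (hC : σ.Invertible C)
    (h : σ (A * B) = σ C) : σ.Invertible A :=
  σ.invertible_of_mul (B := B * C⁻¹) (by
    rw [← mul_assoc, ← σ.map_map_mul, h, σ.map_map_mul]; exact hC)

theorem invertible_spanSingleton {x : K} (hx : x ≠ 0) :
    σ.Invertible (FractionalIdeal.spanSingleton D⁰ x) :=
  σ.invertible_of_mul (B := FractionalIdeal.spanSingleton D⁰ x⁻¹) (by
    rw [FractionalIdeal.spanSingleton_mul_spanSingleton, mul_inv_cancel₀ hx,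
      FractionalIdeal.spanSingleton_one, σ.map_one])

theorem map_span_singleton (x : D) :
    σ ((Ideal.span {x} : Ideal D) : FractionalIdeal D⁰ K) = (Ideal.span {x} : Ideal D) := by
  rw [FractionalIdeal.coeIdeal_span_singleton, σ.map_spanSingleton]

theorem invertible_span_singleton {x : D} (hx : x ≠ 0) :
    σ.Invertible ((Ideal.span {x} : Ideal D) : FractionalIdeal D⁰ K) := by
  rw [FractionalIdeal.coeIdeal_span_singleton]
  exact invertible_spanSingleton (by simpa using hx)

/-- For a `*`-invertible ideal, `A_v = A_*`. -/
theorem Invertible.inv_inv {A : FractionalIdeal D⁰ K} (h : σ.Invertible A) : A⁻¹⁻¹ = σ A := by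
  have hA := h.ne_zero σ
  have hA' : A⁻¹ ≠ 0 := by
    intro h0
    rw [Invertible, h0, mul_zero, σ.map_zero] at h
    exact zero_ne_one h
  refine le_antisymm (fun x hx => ?_) ?_
  · have h1 : FractionalIdeal.spanSingleton D⁰ x * A⁻¹ ≤ 1 := by
      rw [FractionalIdeal.spanSingleton_mul_le_iff]
      exact (FractionalIdeal.mem_inv_iff hA').1 hx
    have h2 := σ.mono (mul_le_mul_left h1 A)
    rw [mul_assoc, mul_comm A⁻¹, one_mul, ← σ.map_mul_map, h, mul_one, σ.map_spanSingleton] at h2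
    exact h2 (FractionalIdeal.mem_spanSingleton_self _ _)
  · rw [FractionalIdeal.inv_eq (I := A⁻¹), FractionalIdeal.le_div_iff_mul_le hA']
    exact (σ.map_mul_le _ _).trans h.le

/-- Some `(A ^ n)_*`, `n ≥ 1`, is principal. -/
def IsPowPrincipal (σ : StarOperation D K) (A : FractionalIdeal D⁰ K) : Prop :=
  ∃ n : ℕ, 0 < n ∧ IsPrincipalFractional (σ (A ^ n))

theorem IsPowPrincipal.congr {A B : FractionalIdeal D⁰ K} (h : σ.IsPowPrincipal A)
    (hAB : σ A = σ B) : σ.IsPowPrincipal B := by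
  obtain ⟨n, hn, hp⟩ := h
  exact ⟨n, hn, by rwa [← map_pow_eq_of_map_eq hAB]⟩

theorem IsPrincipalFractional.map_pow {A : FractionalIdeal D⁰ K}
    (h : IsPrincipalFractional (σ A)) (n : ℕ) : IsPrincipalFractional (σ (A ^ n)) := by
  obtain ⟨c, hc⟩ := h
  refine ⟨c ^ n, ?_⟩
  rw [← FractionalIdeal.spanSingleton_pow, map_pow_eq_of_map_eq (A := A)
    (B := FractionalIdeal.spanSingleton D⁰ c) (by rw [hc, σ.map_spanSingleton]),
    FractionalIdeal.spanSingleton_pow, σ.map_spanSingleton]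

theorem IsPowPrincipal.mul {A B : FractionalIdeal D⁰ K} (hA : σ.IsPowPrincipal A)
    (hB : σ.IsPowPrincipal B) : σ.IsPowPrincipal (A * B) := by
  obtain ⟨n, hn, hA⟩ := hA
  obtain ⟨m, hm, hB⟩ := hB
  obtain ⟨c, hc⟩ := IsPrincipalFractional.map_pow hA m
  obtain ⟨d, hd⟩ := IsPrincipalFractional.map_pow hB n
  refine ⟨n * m, Nat.mul_pos hn hm, c * d, ?_⟩
  rw [mul_pow, pow_mul, mul_comm n m, pow_mul, ← σ.map_map_mul, ← σ.map_mul_map, hc, hd,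
    FractionalIdeal.spanSingleton_mul_spanSingleton, σ.map_spanSingleton]

theorem isPowPrincipal_spanSingleton (c : K) :
    σ.IsPowPrincipal (FractionalIdeal.spanSingleton D⁰ c) :=
  ⟨1, one_pos, c, by rw [pow_one, σ.map_spanSingleton]⟩

theorem isPowPrincipal_one : σ.IsPowPrincipal 1 := by
  rw [← FractionalIdeal.spanSingleton_one]
  exact isPowPrincipal_spanSingleton 1

theorem IsPowPrincipal.pow {A : FractionalIdeal D⁰ K} (hA : σ.IsPowPrincipal A) (k : ℕ) :
    σ.IsPowPrincipal (A ^ k) := by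
  induction k with
  | zero => rw [pow_zero]; exact isPowPrincipal_one
  | succ k ih => rw [pow_succ]; exact ih.mul hA

theorem IsPowPrincipal.of_pow {A : FractionalIdeal D⁰ K} {k : ℕ} (hk : 0 < k)
    (hA : σ.IsPowPrincipal (A ^ k)) : σ.IsPowPrincipal A := by
  obtain ⟨n, hn, hp⟩ := hA
  exact ⟨k * n, Nat.mul_pos hk hn, by rwa [pow_mul]⟩

theorem isPowPrincipal_multiset_prod {s : Multiset (Ideal D)}
    (h : ∀ A ∈ s, σ.IsPowPrincipal (A : FractionalIdeal D⁰ K)) :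
    σ.IsPowPrincipal ((s.prod : Ideal D) : FractionalIdeal D⁰ K) := by
  induction s using Multiset.induction_on with
  | empty =>
    rw [Multiset.prod_zero, Ideal.one_eq_top, FractionalIdeal.coeIdeal_top]
    exact isPowPrincipal_one
  | cons A s ih =>
    rw [Multiset.prod_cons, FractionalIdeal.coeIdeal_mul]
    exact (h A (Multiset.mem_cons_self A s)).mul (ih fun B hB => h B (Multiset.mem_cons_of_mem hB))

theorem Inv.coe_pow (I : σ.Inv) (n : ℕ) : (I ^ n).1 = σ (I.1 ^ n) := by
  induction n with
  | zero => rw [pow_zero, pow_zero, σ.map_one]; rfl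
  | succ n ih =>
    rw [pow_succ, pow_succ]
    change σ ((I ^ n).1 * I.1) = _
    rw [ih, σ.map_map_mul]

theorem isMulTorsion_classGroup_iff :
    IsMulTorsion σ.ClassGroup ↔ ∀ A, σ.Invertible A → σ.IsPowPrincipal A := by
  constructor
  · intro h A hA
    let I : σ.Inv := ⟨σ A, hA.map, σ.map_map A⟩
    obtain ⟨n, hn, hI⟩ := isOfFinOrder_iff_pow_eq_one.1 (h (QuotientGroup.mk I))
    rw [← QuotientGroup.mk_pow, QuotientGroup.eq_one_iff] at hI
    obtain ⟨c, -, hc⟩ := hI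
    refine ⟨n, hn, c, ?_⟩
    rw [← hc, Inv.coe_pow]
    exact map_pow_eq_of_map_eq (σ.map_map A).symm n
  · intro h g
    obtain ⟨I, rfl⟩ := QuotientGroup.mk_surjective g
    obtain ⟨n, hn, c, hc⟩ := h I.1 I.2.1
    refine isOfFinOrder_iff_pow_eq_one.2 ⟨n, hn, ?_⟩
    rw [← QuotientGroup.mk_pow, QuotientGroup.eq_one_iff]
    rw [← Inv.coe_pow] at hc
    refine ⟨c, ?_, hc⟩
    -- `IsPrincipalFractional` permits the generator `0`, but `prin` does not; invertibility
    -- excludes it.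
    rintro rfl
    exact (I ^ n).2.1.ne_zero σ (by rw [hc, FractionalIdeal.spanSingleton_zero])

/-- Up to a principal factor `A` is integral, hence a `*`-product of ideals with the closure of a
power of some `P`. Torsion thus need only be checked on maximal `*`-ideals. -/
theorem Invertible.isPowPrincipal (hσ : σ.FiniteCharacter)
    (hU : ∀ P ∈ σ.maxIdeals, ∃ π, IsLocalUniformizer P π)
    (hfin : ∀ x : D, x ≠ 0 → ¬ IsUnit x → {P ∈ σ.maxIdeals | x ∈ P}.Finite)
    (hpow : ∀ P ∈ σ.maxIdeals, σ.IsPowPrincipal (P : FractionalIdeal D⁰ K))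
    {A : FractionalIdeal D⁰ K} (hA : σ.Invertible A) : σ.IsPowPrincipal A := by
  obtain ⟨a, J, ha, rfl⟩ := FractionalIdeal.exists_eq_spanSingleton_mul A
  have hJ : σ.Invertible (J : FractionalIdeal D⁰ K) :=
    Invertible.of_map_mul_eq hA (by rw [mul_comm])
  obtain ⟨s, hs, hsJ⟩ := Invertible.exists_prod_eq hσ hU hfin hJ
  refine (isPowPrincipal_spanSingleton _).mul
    (IsPowPrincipal.congr (isPowPrincipal_multiset_prod fun C hC => ?_) hsJ.symm)
  obtain ⟨P, hP, n, -, hn⟩ := hs C hC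
  refine IsPowPrincipal.congr ((hpow P hP.mem).pow n) ?_
  rw [hn, FractionalIdeal.coeIdeal_pow]

theorem IsKrullDomain.exists_isLocalUniformizer (h : σ.IsKrullDomain) :
    ∀ P ∈ σ.maxIdeals, ∃ π, IsLocalUniformizer P π := fun P hP => by
  have hPp := h.1.1.prime P hP
  have := h.2 P hP hPp
  exact IsLocalUniformizer.exists_of_isDiscreteValuationRing P

/-! ### From type 2 factorizations of principal ideals to `*`-Krull domains -/

theorem IsType2Homogeneous.mem_of_isHomogeneousAt {A P : Ideal D} (hA : σ.IsType2Homogeneous A)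
    (hP : σ.IsHomogeneousAt A P) : ∃ n : ℕ, 1 ≤ n ∧
      σ (A : FractionalIdeal D⁰ K) = σ ((P ^ n : Ideal D) : FractionalIdeal D⁰ K) := by
  obtain ⟨Q, hQ, h⟩ := hA
  rwa [hP.unique Q hQ.mem hQ.le] at h

/-- Each type 2 factor is replaced by copies of its maximal `*`-ideal. The original factor is
remembered because its afg or af property is needed later. -/
theorem exists_multiset_maxIdeals {s : Multiset (Ideal D)} (hs : ∀ A ∈ s, σ.IsType2Homogeneous A) :
    ∃ m : Multiset (Ideal D), (∀ P ∈ m, P ∈ σ.maxIdeals ∧ ∃ A ∈ s, σ.IsHomogeneousAt A P) ∧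
      σ ((s.prod : Ideal D) : FractionalIdeal D⁰ K) =
        σ ((m.prod : Ideal D) : FractionalIdeal D⁰ K) := by
  induction s using Multiset.induction_on with
  | empty => exact ⟨0, by simp, rfl⟩
  | cons A s ih =>
    obtain ⟨m, hm, hmσ⟩ := ih fun B hB => hs B (Multiset.mem_cons_of_mem hB)
    obtain ⟨P, hP, n, -, hn⟩ := hs A (Multiset.mem_cons_self A s)
    refine ⟨Multiset.replicate n P + m, fun Q hQ => ?_, ?_⟩
    · rcases Multiset.mem_add.1 hQ with hQ | hQ
      · rw [Multiset.eq_of_mem_replicate hQ]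
        exact ⟨hP.mem, A, Multiset.mem_cons_self A s, hP⟩
      · obtain ⟨h1, B, hB, h2⟩ := hm Q hQ
        exact ⟨h1, B, Multiset.mem_cons_of_mem hB, h2⟩
    · rw [Multiset.prod_cons, Multiset.prod_add, Multiset.prod_replicate,
        FractionalIdeal.coeIdeal_mul, FractionalIdeal.coeIdeal_mul, ← σ.map_map_mul, hn,
        σ.map_map_mul, ← σ.map_mul_map, hmσ, σ.map_mul_map]

section Factorization

variable (H : ∀ x : D, x ≠ 0 → ∃ m : Multiset (Ideal D), (∀ P ∈ m, P ∈ σ.maxIdeals) ∧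
  ((Ideal.span {x} : Ideal D) : FractionalIdeal D⁰ K) =
    σ ((m.prod : Ideal D) : FractionalIdeal D⁰ K))

theorem le_span_singleton_of_eq_map {x : D} {B : Ideal D}
    (h : ((Ideal.span {x} : Ideal D) : FractionalIdeal D⁰ K) =
      σ (B : FractionalIdeal D⁰ K)) : B ≤ Ideal.span {x} := by
  rw [← FractionalIdeal.coeIdeal_le_coeIdeal K, h]
  exact σ.le_map _

theorem mem_of_span_eq_prod {x : D} {m : Multiset (Ideal D)} (hm : ∀ P ∈ m, P ∈ σ.maxIdeals)
    (h : ((Ideal.span {x} : Ideal D) : FractionalIdeal D⁰ K) =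
      σ ((m.prod : Ideal D) : FractionalIdeal D⁰ K)) {P : Ideal D} (hP : P ∈ σ.maxIdeals)
    (hx : x ∈ P) : P ∈ m := by
  obtain ⟨Q, hQ, hQP⟩ := (maxIdeals.isPrime hP).multiset_prod_le.1
    ((le_span_singleton_of_eq_map h).trans ((Ideal.span_singleton_le_iff_mem P).2 hx))
  exact maxIdeals.eq_of_le (hm Q hQ) hP hQP ▸ hQ

include H

theorem invertible_maxIdeals_of_factorization {P : Ideal D} (hP : P ∈ σ.maxIdeals) :
    σ.Invertible (P : FractionalIdeal D⁰ K) := by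
  obtain ⟨x, hxP, hx⟩ := Submodule.exists_mem_ne_zero_of_ne_bot (maxIdeals.ne_bot hP)
  obtain ⟨m, hm, h⟩ := H x hx
  obtain ⟨m', rfl⟩ := Multiset.exists_cons_of_mem (mem_of_span_eq_prod hm h hP hxP)
  rw [Multiset.prod_cons, FractionalIdeal.coeIdeal_mul] at h
  exact Invertible.of_map_mul_eq (invertible_span_singleton hx)
    (h.symm.trans (map_span_singleton x).symm)

/-- A local generator `a` of the `*`-invertible ideal `P` works: if `P` occurs `n` times in the
factorization of `(x)`, the other factors are trivial at `P`, so `x` and `a ^ n` are locally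
associated. -/
theorem exists_isLocalUniformizer_of_factorization {P : Ideal D} (hP : P ∈ σ.maxIdeals) :
    ∃ π, IsLocalUniformizer P π := by
  classical
  have hPp := maxIdeals.isPrime hP
  obtain ⟨a, haP, ha0, t, ht, hd⟩ :=
    (invertible_maxIdeals_of_factorization H hP).exists_dvd_mul hP
  refine ⟨a, ha0, haP, fun x hx => ?_⟩
  obtain ⟨m, hm, h⟩ := H x hx
  have hsplit : m.prod = P ^ m.count P * (m.filter fun Q => ¬ P = Q).prod := by
    rw [← Multiset.prod_replicate, ← Multiset.filter_eq, ← Multiset.prod_add,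
      Multiset.filter_add_not]
  set n := m.count P
  set M := (m.filter fun Q => ¬ P = Q).prod
  obtain ⟨c, hcM, hcP⟩ : ∃ c ∈ M, c ∉ P := Set.not_subset.1 fun hle => by
    obtain ⟨Q, hQ, hQP⟩ := hPp.multiset_prod_le.1 hle
    rw [Multiset.mem_filter] at hQ
    exact hQ.2 (maxIdeals.eq_of_le (hm Q hQ.1) hP hQP).symm
  obtain ⟨d, hxd⟩ := Ideal.mem_span_singleton.1 (le_span_singleton_of_eq_map h
    (hsplit ▸ Ideal.mul_mem_mul (Ideal.pow_mem_pow haP n) hcM))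
  have hle : Ideal.span {t} * P ≤ Ideal.span {a} := by
    rw [Ideal.span_singleton_mul_le_iff]
    exact fun b hb => Ideal.mem_span_singleton.2 (hd b hb)
  have hpow := Ideal.pow_right_mono hle n
  rw [mul_pow, Ideal.span_singleton_pow, Ideal.span_singleton_pow] at hpow
  have hle2 : Ideal.span {t ^ n} * m.prod ≤ Ideal.span {a ^ n} := by
    rw [hsplit, ← mul_assoc]
    exact Ideal.mul_le_left.trans hpow
  -- The bound passes from the product to its closure `(x)` because `(a ^ n)` is closed.
  have hle3 : Ideal.span {t ^ n} * Ideal.span {x} ≤ Ideal.span {a ^ n} := by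
    rw [← FractionalIdeal.coeIdeal_le_coeIdeal K, FractionalIdeal.coeIdeal_mul, h, mul_comm]
    refine (σ.map_mul_le _ _).trans ?_
    rw [mul_comm, ← FractionalIdeal.coeIdeal_mul, ← map_span_singleton (σ := σ)]
    exact σ.mono ((FractionalIdeal.coeIdeal_le_coeIdeal K).2 hle2)
  obtain ⟨e, he⟩ := Ideal.mem_span_singleton.1 (hle3 (Ideal.mul_mem_mul
    (Ideal.mem_span_singleton_self _) (Ideal.mem_span_singleton_self _)))
  have htn : t ^ n ∉ P := fun h => ht (hPp.mem_of_pow_mem n h)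
  refine ⟨n, t ^ n, e, htn, fun heP => ?_, by rw [he, mul_comm]⟩
  -- Combining both divisibilities exhibits `e` as a divisor of an element outside `P`.
  have hed : t ^ n * c = e * d := mul_left_cancel₀ (pow_ne_zero n ha0) (by
    linear_combination t ^ n * hxd + d * he)
  exact hPp.mul_notMem htn hcP (hed ▸ P.mul_mem_right d heP)

theorem isKrullDomain_of_factorization (hσ : σ.FiniteCharacter) : σ.IsKrullDomain := by
  classical
  have hU : ∀ P ∈ σ.maxIdeals, ∃ π, IsLocalUniformizer P π :=
    fun P hP => exists_isLocalUniformizer_of_factorization H hP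
  refine ⟨⟨⟨fun P hP => maxIdeals.isPrime hP, ?_, ?_, ?_⟩, ?_⟩, ?_⟩
  · refine Set.Subset.antisymm (fun z hz => ?_) ?_
    · rw [Set.mem_iInter₂] at hz
      have hz1 : z ∈ σ (1 : FractionalIdeal D⁰ K) := by
        refine mem_map_of_local hσ one_ne_zero fun P hP => ?_
        obtain ⟨a, s, hs, rfl⟩ := hz P hP
        have hs0 : algebraMap D K s ≠ 0 := by
          rw [Ne, FaithfulSMul.algebraMap_eq_zero_iff]
          rintro rfl
          exact hs P.zero_mem
        exact ⟨s, hs, (FractionalIdeal.mem_one_iff _).2 ⟨a, by rw [mul_div_cancel₀ _ hs0]⟩⟩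
      rw [σ.map_one] at hz1
      exact (FractionalIdeal.mem_one_iff _).1 hz1
    · rintro _ ⟨d, rfl⟩
      rw [Set.mem_iInter₂]
      exact fun P hP => ⟨d, 1, (maxIdeals.isPrime hP).one_notMem, by simp⟩
  · intro x hx _
    obtain ⟨m, hm, h⟩ := H x hx
    exact m.toFinset.finite_toSet.subset fun P hP =>
      Multiset.mem_toFinset.2 (mem_of_span_eq_prod hm h hP.1 hP.2)
  · intro P hP Q hQ hne R hR hRP hRQ
    by_contra h0
    obtain ⟨π, hπ⟩ := hU P hP
    obtain ⟨ρ, hρ⟩ := hU Q hQ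
    exact hne ((hπ.eq_of_le hR h0 hRP).symm.trans (hρ.eq_of_le hR h0 hRQ))
  · ext Q
    constructor
    · intro hQ
      have := maxIdeals.isPrime hQ
      obtain ⟨π, hπ⟩ := hU Q hQ
      exact ⟨this, hπ.height_eq_one⟩
    · rintro ⟨hQ, hQ1⟩
      obtain ⟨x, hxQ, hx⟩ :=
        Submodule.exists_mem_ne_zero_of_ne_bot (Ideal.ne_bot_of_height_eq_one hQ1)
      obtain ⟨m, hm, h⟩ := H x hx
      -- A height-one prime contains some factor `P` of `(x)`; as `P` is a nonzero prime, they
      -- coincide.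
      obtain ⟨P, hP, hPQ⟩ := hQ.multiset_prod_le.1
        ((le_span_singleton_of_eq_map h).trans ((Ideal.span_singleton_le_iff_mem Q).2 hxQ))
      have hPp := maxIdeals.isPrime (hm P hP)
      have : P = Q := by
        by_contra hne
        have hlt := (Ideal.height_le_iff (n := 1)).1 hQ1.le P hPp (lt_of_le_of_ne hPQ hne)
        rw [Nat.cast_one, Order.lt_one_iff, Ideal.height_eq_zero_iff_eq_bot] at hlt
        exact maxIdeals.ne_bot (hm P hP) hlt
      exact this ▸ hm P hP
  · intro P hP _
    obtain ⟨π, hπ⟩ := hU P hP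
    exact hπ.isDiscreteValuationRing

end Factorization

/-! ### The AGCD, afg and af conditions against torsion of the class group -/

theorem PrincipalIdealsAreProductsOf.exists_multiset {p : Ideal D → Prop}
    (h : σ.PrincipalIdealsAreProductsOf p) (hp : ∀ A, p A → σ.IsType2Homogeneous A)
    (x : D) (hx : x ≠ 0) : ∃ m : Multiset (Ideal D),
      (∀ P ∈ m, P ∈ σ.maxIdeals ∧ ∃ A, p A ∧ σ.IsHomogeneousAt A P) ∧
      ((Ideal.span {x} : Ideal D) : FractionalIdeal D⁰ K) =
        σ ((m.prod : Ideal D) : FractionalIdeal D⁰ K) := by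
  by_cases hu : IsUnit x
  · refine ⟨0, by simp, ?_⟩
    rw [Ideal.span_singleton_eq_top.2 hu, Multiset.prod_zero, Ideal.one_eq_top,
      FractionalIdeal.coeIdeal_top, σ.map_one]
  · obtain ⟨s, hs, hsx⟩ := h x hx hu
    obtain ⟨m, hm, hmσ⟩ := exists_multiset_maxIdeals fun A hA => hp A (hs A hA)
    refine ⟨m, fun P hP => ?_, hsx.trans hmσ⟩
    obtain ⟨h1, A, hA, h2⟩ := hm P hP
    exact ⟨h1, A, hs A hA, h2⟩

theorem PrincipalIdealsAreProductsOf.isKrullDomain (hσ : σ.FiniteCharacter) {p : Ideal D → Prop}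
    (h : σ.PrincipalIdealsAreProductsOf p) (hp : ∀ A, p A → σ.IsType2Homogeneous A) :
    σ.IsKrullDomain := by
  refine isKrullDomain_of_factorization (fun x hx => ?_) hσ
  obtain ⟨m, hm, hmx⟩ := h.exists_multiset hp x hx
  exact ⟨m, fun P hP => (hm P hP).1, hmx⟩

theorem PrincipalIdealsAreProductsOf.exists_isHomogeneousAt {p : Ideal D → Prop}
    (h : σ.PrincipalIdealsAreProductsOf p) (hp : ∀ A, p A → σ.IsType2Homogeneous A)
    {P : Ideal D} (hP : P ∈ σ.maxIdeals) : ∃ A, p A ∧ σ.IsHomogeneousAt A P := by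
  obtain ⟨x, hxP, hx⟩ := Submodule.exists_mem_ne_zero_of_ne_bot (maxIdeals.ne_bot hP)
  obtain ⟨m, hm, hmx⟩ := h.exists_multiset hp x hx
  exact (hm P (mem_of_span_eq_prod (fun Q hQ => (hm Q hQ).1) hmx hP hxP)).2

theorem IsKrullDomain.isMulTorsion_classGroup (hσ : σ.FiniteCharacter) (h : σ.IsKrullDomain)
    (hpow : ∀ P ∈ σ.maxIdeals, σ.IsPowPrincipal (P : FractionalIdeal D⁰ K)) :
    IsMulTorsion σ.ClassGroup :=
  isMulTorsion_classGroup_iff.2 fun _ hA =>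
    hA.isPowPrincipal hσ h.exists_isLocalUniformizer h.1.1.finite hpow

theorem IsKrullDomain.map_span_pair_pow (hσ : σ.FiniteCharacter) (h : σ.IsKrullDomain) {a : D}
    (ha : a ≠ 0) (b : D) (n : ℕ) :
    σ ((Ideal.span {a ^ n, b ^ n} : Ideal D) : FractionalIdeal D⁰ K) =
      σ ((Ideal.span {a, b} : Ideal D) ^ n : FractionalIdeal D⁰ K) := by
  have hr : Set.range ![a, b] = {a, b} := by simp [Set.pair_comm]
  have hrn : (Set.range fun i => ![a, b] i ^ n) = {a ^ n, b ^ n} := by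
    ext x
    simp [Fin.exists_fin_two, eq_comm]
  rw [← hr, ← hrn]
  refine map_span_pow hσ h.exists_isLocalUniformizer _ ?_ n
  rw [hr]
  exact fun h0 => ha (Ideal.span_eq_bot.1 h0 a (by simp))

theorem IsKrullDomain.invertible_span_pair (hσ : σ.FiniteCharacter) (h : σ.IsKrullDomain) {a : D}
    (ha : a ≠ 0) (b : D) :
    σ.Invertible ((Ideal.span {a, b} : Ideal D) : FractionalIdeal D⁰ K) :=
  invertible_of_fg hσ h.exists_isLocalUniformizer (Submodule.fg_span (Set.toFinite _))
    fun h0 => ha (Ideal.span_eq_bot.1 h0 a (by simp))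

theorem IsKrullDomain.isAGCDDomain (hσ : σ.FiniteCharacter) (h : σ.IsKrullDomain)
    (ht : IsMulTorsion σ.ClassGroup) : IsAGCDDomain D K := by
  intro a b ha _
  obtain ⟨n, hn, hp⟩ := isMulTorsion_classGroup_iff.1 ht _ (h.invertible_span_pair hσ ha b)
  refine ⟨n, hn, ?_⟩
  rwa [(h.invertible_span_pair hσ (pow_ne_zero n ha) (b ^ n)).inv_inv, h.map_span_pair_pow hσ ha]

/-- The AGCD condition is applied to the two `*`-generators of each `P`; there the `v`-closure is
the `*`-closure, by invertibility. -/
theorem IsKrullDomain.isMulTorsion_of_isAGCDDomain (hσ : σ.FiniteCharacter)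
    (h : σ.IsKrullDomain) (hD : IsAGCDDomain D K) : IsMulTorsion σ.ClassGroup := by
  refine h.isMulTorsion_classGroup hσ fun P hP => ?_
  obtain ⟨π, hπ⟩ := h.exists_isLocalUniformizer P hP
  obtain ⟨b, hb, -, hBσ⟩ := exists_isHomogeneousAt_span_pair hσ h.1.1.finite hP hπ
  obtain ⟨n, hn, hp⟩ := hD π b hπ.ne_zero hb
  rw [(h.invertible_span_pair hσ (pow_ne_zero n hπ.ne_zero) (b ^ n)).inv_inv,
    h.map_span_pair_pow hσ hπ.ne_zero] at hp
  exact IsPowPrincipal.congr ⟨n, hn, hp⟩ (by rw [hBσ, maxIdeals.map_eq hP])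

theorem IsType2AfgSHDomain.isMulTorsion_classGroup (hσ : σ.FiniteCharacter)
    (h : σ.IsType2AfgSHDomain) : IsMulTorsion σ.ClassGroup := by
  have hK := h.isKrullDomain hσ fun A hA => hA.2
  refine hK.isMulTorsion_classGroup hσ fun P hP => ?_
  obtain ⟨A, ⟨⟨Q, hQ, -, hA⟩, -⟩, hAP⟩ := h.exists_isHomogeneousAt (fun A hA => hA.2) hP
  obtain rfl := hQ.unique P hAP.mem hAP.le
  obtain ⟨π, hπ⟩ := hK.exists_isLocalUniformizer P hP
  obtain ⟨b, -, hB, hBσ⟩ := exists_isHomogeneousAt_span_pair hσ hK.1.1.finite hP hπ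
  have hr : Set.range ![π, b] = {π, b} := by simp [Set.pair_comm]
  have hrn : ∀ n, (Set.range fun i => ![π, b] i ^ n) = {π ^ n, b ^ n} := by
    intro n
    ext x
    simp [Fin.exists_fin_two, eq_comm]
  -- The afg condition applies to the two `*`-generators of `P` with `r = 1`, as `A ⊆ P = (π, b)_*`.
  obtain ⟨n, hn, hp⟩ := hA 2 ![π, b] (fun i => hB.le (Ideal.subset_span (hr ▸ ⟨i, rfl⟩)))
    ⟨1, one_pos, by
      rw [hr, hBσ, pow_one, FractionalIdeal.coeIdeal_le_coeIdeal]
      exact hAP.le⟩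
  rw [hrn, hK.map_span_pair_pow hσ hπ.ne_zero] at hp
  exact IsPowPrincipal.congr ⟨n, hn, hp⟩ (by rw [hBσ, maxIdeals.map_eq hP])

theorem IsType2AfSHDomain.isMulTorsion_classGroup (hσ : σ.FiniteCharacter)
    (h : σ.IsType2AfSHDomain) : IsMulTorsion σ.ClassGroup := by
  have hK := h.isKrullDomain hσ fun A hA => hA.2
  refine hK.isMulTorsion_classGroup hσ fun P hP => ?_
  obtain ⟨A, ⟨⟨hA, hpow⟩, h2⟩, hAP⟩ := h.exists_isHomogeneousAt (fun A hA => hA.2) hP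
  -- Taking `B = A` suffices: `A` has the closure of some `P ^ k`, so a power of `P` has principal
  -- closure.
  obtain ⟨n, hn, hp⟩ := hpow A hA le_rfl
  rw [FractionalIdeal.coeIdeal_pow] at hp
  obtain ⟨k, hk, hAk⟩ := h2.mem_of_isHomogeneousAt hAP
  rw [FractionalIdeal.coeIdeal_pow] at hAk
  exact IsPowPrincipal.of_pow hk (IsPowPrincipal.congr ⟨n, hn, hp⟩ hAk)

theorem IsKrullDomain.isAfHomogeneous (hσ : σ.FiniteCharacter) (h : σ.IsKrullDomain)
    (ht : IsMulTorsion σ.ClassGroup) {A : Ideal D} (hA : σ.IsHomogeneous A) :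
    σ.IsAfHomogeneous A := by
  refine ⟨hA, fun B ⟨P, hB⟩ _ => ?_⟩
  obtain ⟨n, hn, hp⟩ := isMulTorsion_classGroup_iff.1 ht _
    (invertible_of_fg hσ h.exists_isLocalUniformizer hB.fg hB.ne_bot)
  exact ⟨n, hn, by rwa [FractionalIdeal.coeIdeal_pow]⟩

theorem IsKrullDomain.isAfgHomogeneous (hσ : σ.FiniteCharacter) (h : σ.IsKrullDomain)
    (ht : IsMulTorsion σ.ClassGroup) {A : Ideal D} (hA : σ.IsHomogeneous A) :
    σ.IsAfgHomogeneous A := by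
  obtain ⟨P, hA⟩ := hA
  have hU := h.exists_isLocalUniformizer
  refine ⟨P, hA, invertible_of_fg hσ hU hA.fg hA.ne_bot, fun s b _ ⟨r, _, hr⟩ => ?_⟩
  -- The `b i` are not all zero, since their closure contains the nonzero ideal `A ^ r`.
  have hb : Ideal.span (Set.range b) ≠ ⊥ := by
    intro h0
    rw [h0, FractionalIdeal.coeIdeal_bot, σ.map_zero] at hr
    exact pow_ne_zero r hA.ne_bot (FractionalIdeal.coeIdeal_eq_zero.1
      (le_antisymm hr (FractionalIdeal.zero_le _)))
  obtain ⟨n, hn, hp⟩ := isMulTorsion_classGroup_iff.1 ht _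
    (invertible_of_fg hσ hU (Submodule.fg_span (Set.finite_range b)) hb)
  exact ⟨n, hn, by rwa [map_span_pow hσ hU b hb]⟩

theorem IsStarProductOf.mono {p q : Ideal D → Prop} (h : ∀ A, p A → q A)
    {I : FractionalIdeal D⁰ K} (hI : σ.IsStarProductOf p I) : σ.IsStarProductOf q I := by
  obtain ⟨s, hs, hI⟩ := hI
  exact ⟨s, fun A hA => h A (hs A hA), hI⟩

theorem IsType2Homogeneous.isHomogeneous {A : Ideal D} (h : σ.IsType2Homogeneous A) :
    σ.IsHomogeneous A := by
  obtain ⟨P, hP, -⟩ := h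
  exact ⟨P, hP⟩

end StarOperation

theorem corollary5p8 {D K : Type*} [CommRing D] [IsDomain D] [Field K] [Algebra D K]
    [IsFractionRing D K] (σ : StarOperation D K) (hσ : σ.FiniteCharacter) :
    List.TFAE [
      σ.IsType2AfgSHDomain,
      σ.IsKrullDomain ∧ IsAGCDDomain D K,
      ∀ A : Ideal D, A.FG → σ.Invertible (A : FractionalIdeal D⁰ K) →
        σ (A : FractionalIdeal D⁰ K) ≠ 1 →
        σ.IsStarProductOf (fun B => σ.IsAfgHomogeneous B ∧ σ.IsType2Homogeneous B)
          (σ (A : FractionalIdeal D⁰ K)),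
      σ.IsKrullDomain ∧ IsMulTorsion σ.ClassGroup,
      σ.IsType2AfSHDomain] := by
  tfae_have 1 → 4 := fun h =>
    ⟨h.isKrullDomain hσ fun A hA => hA.2,
      StarOperation.IsType2AfgSHDomain.isMulTorsion_classGroup hσ h⟩
  tfae_have 5 → 4 := fun h =>
    ⟨h.isKrullDomain hσ fun A hA => hA.2,
      StarOperation.IsType2AfSHDomain.isMulTorsion_classGroup hσ h⟩
  tfae_have 4 → 2 := fun h => ⟨h.1, h.1.isAGCDDomain hσ h.2⟩
  tfae_have 2 → 4 := fun h => ⟨h.1, h.1.isMulTorsion_of_isAGCDDomain hσ h.2⟩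
  tfae_have 4 → 3 := fun ⟨h, ht⟩ A _ hA _ =>
    (hA.exists_prod_eq hσ h.exists_isLocalUniformizer h.1.1.finite).mono
      fun _ hB => ⟨h.isAfgHomogeneous hσ ht hB.isHomogeneous, hB⟩
  tfae_have 3 → 1 := fun h x hx hu => by
    have h1 := h (Ideal.span {x}) ⟨{x}, by simp⟩
      (StarOperation.invertible_span_singleton hx)
    rw [StarOperation.map_span_singleton, Ne, FractionalIdeal.coeIdeal_eq_one, Ideal.one_eq_top,
      Ideal.span_singleton_eq_top] at h1
    exact h1 hu
  tfae_have 4 → 5 := fun ⟨h, ht⟩ x hx _ => by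
    have h1 := (StarOperation.invertible_span_singleton (σ := σ) hx).exists_prod_eq hσ
      h.exists_isLocalUniformizer h.1.1.finite
    rw [StarOperation.map_span_singleton] at h1
    exact h1.mono fun _ hB => ⟨h.isAfHomogeneous hσ ht hB.isHomogeneous, hB⟩
  tfae_finish
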